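/- Let $S_0$ be the triangle graph, and for $n\ge 1$ let the Sierpiński gasket $S_n$ be obtained from $S_{n-1}$ by bisecting the three sides of every upward pointing triangle and removing the central triangle. Then $S_n$ has $N_n=\frac{3^{n+1}+3}{2}$ vertices and $3^{n+1}$ edges. For a connected graph with $N$ vertices and Laplacian matrix $\mathbf L$ with eigenvalues $0=\lambda_1<\lambda_2\le\dots\le\lambda_N$, the first-order coherence $H_{\rm FO}$ is the limit, as $t\to\infty$, of the mean over the vertices $i$ of the variance of $x_i(t)-\frac1N\sum_j x_j(t)$, where $\dot x=-\mathbf L x+w$ and $w$ is a vector of independent Gaussian white noises with zero mean and unit variance; the second-order coherence $H_{\rm SO}$ is the same quantity for the positions $x_1$ in the system $\dot x_1=x_2$, $\dot x_2=-\mathbf L x_1-\mathbf L x_2+w$. For $S_n$ with $n\ge 1$, these limits exist and, with $\lambda_i=\lambda_i(n)$ the Laplacian eigenvalues of $S_n$, $$H_{\rm FO}(n)=\frac1{2N_n}\sum_{i=2}^{N_n}\frac1{\lambda_i}=\frac{4\cdot 3^n+2\cdot 3^{1+2n}-3^{1+3n}+13\cdot 3^{1+n}5^n+4\cdot 5^{1+n}+14\cdot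 45^n}{20\cdot 3^{2+n}(1+3^n)^2},$$ and $H_{\rm SO}(n)=\frac1{2N_n}\sum_{i=2}^{N_n}\frac1{\lambda_i^2}=\dfrac{P_n}{400\,(1+3^n)^3\,9^{2+n}}$ with $$\begin{aligned}P_n={}&86\cdot 3^{1+4n}-2\cdot 3^{2+5n}+754\cdot 3^{1+2n}5^n+568\cdot 3^{1+3n}5^n+32\cdot 3^{2+n}5^{1+2n}+119\cdot 9^n\\&+28\cdot 5^n9^{1+2n}+64\cdot 15^{1+n}+8\cdot 9^{1+2n}25^n+24\cdot 25^{1+n}+320\cdot 27^n+1237\cdot 225^n+394\cdot 675^n.\end{aligned}$$ Moreover, as $n\to\infty$ (where $\sim$ means that the ratio tends to $1$), $$H_{\rm FO}(n)\sim\frac7{90}\Big(\frac{2N_n}{3}\Big)^{\log_3 5-1},\qquad H_{\rm SO}(n)\sim\frac1{450}\Big(\frac{2N_n}{3}\Big)^{\log_3 25-1},$$ and $H_{\rm SO}(n)$ grows superlinearly: $H_{\rm SO}(n)/N_n\to\infty$. -/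

import Mathlib

open MeasureTheory ProbabilityTheory Filter Topology Asymptotics
open scoped NNReal Matrix

/-! ### Sierpinski gaskets

Coordinates: the lattice point `(a, b)` stands for `a • e₁ + b • e₂`, where `e₁`, `e₂` are two
sides of an equilateral triangle.  The outer triangle of the `n`-th gasket is drawn with side
length `2 ^ n`, so that the smallest upward pointing triangles always have side length `1`. -/

/-- The lower left corners of the upward pointing unit triangles of the `n`-th gasket.  Bisecting
the three sides of every upward triangle and removing the central triangle replaces (after
rescaling by `2`) each triangle by three triangles. -/
def upTriangles : ℕ → Finset (ℕ × ℕ)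
  | 0 => {(0, 0)}
  | n + 1 => (upTriangles n).biUnion fun p =>
      {(2 * p.1, 2 * p.2), (2 * p.1 + 1, 2 * p.2), (2 * p.1, 2 * p.2 + 1)}

/-- The three corners of the upward pointing unit triangle whose lower left corner is `p`. -/
def corners (p : ℕ × ℕ) : Finset (ℕ × ℕ) :=
  {(p.1, p.2), (p.1 + 1, p.2), (p.1, p.2 + 1)}

/-- The vertex set of the `n`-th gasket. -/
def gasketVertices (n : ℕ) : Finset (ℕ × ℕ) :=
  (upTriangles n).biUnion corners

/-- The `n`-th Sierpinski gasket: two distinct vertices are adjacent iff they are corners of the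
same upward pointing unit triangle. -/
def gasket (n : ℕ) : SimpleGraph (gasketVertices n) where
  Adj u v := u ≠ v ∧ ∃ p ∈ upTriangles n, u.1 ∈ corners p ∧ v.1 ∈ corners p
  symm := ⟨fun _ _ h => ⟨h.1.symm, h.2.imp fun _ hp => ⟨hp.1, hp.2.2, hp.2.1⟩⟩⟩
  loopless := ⟨fun _ h => h.1 rfl⟩

instance (n : ℕ) : DecidableRel (gasket n).Adj := fun u v =>
  inferInstanceAs
    (Decidable (u ≠ v ∧ ∃ p ∈ upTriangles n, u.1 ∈ corners p ∧ v.1 ∈ corners p))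

/-! ### Noisy consensus dynamics and network coherence -/

/-- `X` solves the linear system `dX/dt = A X + B w`, where `w` is a vector of independent
Gaussian white noises of zero mean and unit intensity, that is `w = dW/dt` for independent standard
Brownian motions `W j`.  The equation is read in integrated form
`X t = X 0 + ∫ s in 0..t, A X s + B W t`.  The initial state may be any square integrable random
vector (in particular, any deterministic vector). -/
structure IsNoisyLinearSystem {ι κ Ω : Type*} [Fintype ι] [Fintype κ] [MeasurableSpace Ω]
    (A : Matrix ι ι ℝ) (B : Matrix ι κ ℝ) (P : Measure Ω)
    (W : κ → ℝ≥0 → Ω → ℝ) (X : ℝ≥0 → Ω → ι → ℝ) : Prop where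
  brownian : ∀ j, IsBrownianReal (W j) P
  indep : iIndepFun (fun j ω t => W j t ω) P
  aemeasurable : ∀ t i, AEMeasurable (fun ω => X t ω i) P
  initial : ∀ i, MemLp (fun ω => X 0 ω i) 2 P
  equation : ∀ᵐ ω ∂P, Continuous (fun t => X t ω) ∧ ∀ t i,
    X t ω i = X 0 ω i + (∫ s in (0 : ℝ)..t, (A *ᵥ X s.toNNReal ω) i)
      + (B *ᵥ fun j => W j t ω) i

/-- The mean (over the vertices `i`) of the variance of the deviation of `x i` from the average of
all the states. -/
noncomputable def meanDeviationVariance {V Ω : Type*} [Fintype V] [MeasurableSpace Ω]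
    (P : Measure Ω) (x : Ω → V → ℝ) : ℝ :=
  (1 / (Fintype.card V : ℝ)) *
    ∑ i, Var[fun ω => x ω i - (1 / (Fintype.card V : ℝ)) * ∑ j, x ω j; P]

universe u

section Coherence

universe v

variable {V : Type v} [Fintype V] [DecidableEq V] (G : SimpleGraph V) [DecidableRel G.Adj]

/-- `h` is the first-order network coherence of `G`: the mean steady-state variance of the deviation
from the average, for the dynamics `dx/dt = -L x + w`. -/
def IsFirstOrderCoherence (h : ℝ) : Prop :=
  ∀ (Ω : Type u) [MeasurableSpace Ω] (P : Measure Ω) [IsProbabilityMeasure P]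
    (W : V → ℝ≥0 → Ω → ℝ) (X : ℝ≥0 → Ω → V → ℝ),
    IsNoisyLinearSystem (-G.lapMatrix ℝ) (1 : Matrix V V ℝ) P W X →
    Tendsto (fun t => meanDeviationVariance P (X t)) atTop (𝓝 h)

/-- `h` is the second-order network coherence of `G`: the mean steady-state variance of the
deviation of the positions `x₁` from their average, for the dynamics
`dx₁/dt = x₂`, `dx₂/dt = -L x₁ - L x₂ + w`.  The coordinates `Sum.inl i` are the positions, the
coordinates `Sum.inr i` the velocities. -/
def IsSecondOrderCoherence (h : ℝ) : Prop :=
  ∀ (Ω : Type u) [MeasurableSpace Ω] (P : Measure Ω) [IsProbabilityMeasure P]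
    (W : V → ℝ≥0 → Ω → ℝ) (X : ℝ≥0 → Ω → V ⊕ V → ℝ),
    IsNoisyLinearSystem
      (Matrix.fromBlocks 0 1 (-G.lapMatrix ℝ) (-G.lapMatrix ℝ))
      (Matrix.fromRows (0 : Matrix V V ℝ) (1 : Matrix V V ℝ)) P W X →
    Tendsto (fun t => meanDeviationVariance P (fun ω i => X t ω (Sum.inl i))) atTop (𝓝 h)

/-- The eigenvalues (with multiplicity) of the Laplacian matrix of `G`. -/
noncomputable def lapEigenvalues : V → ℝ :=
  (G.posSemidef_lapMatrix ℝ).isHermitian.eigenvalues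

/-- `1 / (2 N)` times the sum of the reciprocals of the nonzero Laplacian eigenvalues. -/
noncomputable def firstOrderCoherence : ℝ :=
  1 / (2 * (Fintype.card V : ℝ)) *
    ∑ i with lapEigenvalues G i ≠ 0, 1 / lapEigenvalues G i

/-- `1 / (2 N)` times the sum of the reciprocals of the squares of the nonzero Laplacian
eigenvalues. -/
noncomputable def secondOrderCoherence : ℝ :=
  1 / (2 * (Fintype.card V : ℝ)) *
    ∑ i with lapEigenvalues G i ≠ 0, 1 / lapEigenvalues G i ^ 2

end Coherence

/-! ### Complexes of triangular cells and their subdivision -/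

open scoped Kronecker

section Cells

variable {U V R : Type*}

/-! The spectral half is an exact renormalisation of a determinant. The Laplacian L of a complex of
triangles is a sum of one 3 × 3 block per cell. After subdivision the midpoints interact only inside
their old cell, so a Schur complement removes them cell by cell, and what remains is again a
combination of the identity, the cell-counting matrix D and L (`det_subdivide`). Let ordinary
vertices, which lie in two cells, carry mass x, and the three outer corners, which lie in one cell,
carry mass x(1 + ρ)/2. Then one elimination is the map x ↦ x(5 + x), ρ ↦ ρ(2 + x)/(6 + x), up to
explicit scalar factors (`massDet_succ`). Starting from ρ = 1, where the determinant is det(x + L) =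
∏(x + λ), n steps end at a 3 × 3 determinant.

Only the logarithm up to order two in x matters: for the product over λ ≠ 0 its coefficients are ∑
1/λ and -½ ∑ 1/λ². These coefficients add over products (`HasLogJet.mul`), so the recursion turns
into geometric sums (`massDet_decimation`, `massDet_X_one`). Exactly one factor x splits off, so 0
is a simple eigenvalue; this takes the place of connectedness. Closed forms and asymptotics follow
by algebra.

The stochastic half diagonalises the dynamics by Laplacian eigenvectors. A linear functional of the
solution is tested against the adjoint equation, which writes it as a decaying functional of the
initial state plus Wiener integrals. Integration by parts defines the latter pathwise, so no
stochastic integration theory enters, and their variance follows from Cov(W_s, W_r) = min(s, r) and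
Fubini. A mode with eigenvalue λ contributes ∫ e^{-2λs} ds = 1/(2λ) in first order and, by a
Lyapunov function, 1/(2λ²) in second order (`tendsto_integral_exp`, `exists_dampedMode`).
Subtracting the average removes precisely the zero mode. -/

/-- The incidence matrix between vertices and corners of cells, where the cell `p` has the corners
`c p 0`, `c p 1`, `c p 2`. -/
def cornerIncidence [DecidableEq V] (R : Type*) [Zero R] [One R] (c : U → Fin 3 → V) :
    Matrix V (U × Fin 3) R :=
  Matrix.of fun v p => if c p.1 p.2 = v then 1 else 0

/-- The symmetric `3 × 3` matrix with `a` on the diagonal and `b` elsewhere. -/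
def twoValued {R : Type*} (a b : R) : Matrix (Fin 3) (Fin 3) R :=
  !![a, b, b; b, a, b; b, b, a]

/-- The Laplacian matrix of a complex of triangles. -/
def cellLaplacian [DecidableEq V] [Fintype U] [DecidableEq U] (R : Type*) [CommRing R]
    (c : U → Fin 3 → V) : Matrix V V R :=
  cornerIncidence R c * ((1 : Matrix U U R) ⊗ₖ twoValued (2 : R) (-1)) * (cornerIncidence R c)ᵀ

/-- The diagonal matrix that counts the cells at each vertex. -/
def cellDegree [DecidableEq V] [Fintype U] (R : Type*) [CommRing R]
    (c : U → Fin 3 → V) : Matrix V V R :=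
  cornerIncidence R c * (cornerIncidence R c)ᵀ

/-- Subdividing each cell into three: the vertex `Sum.inr (p, k)` is the midpoint of the side of
the cell `p` opposite to its `k`-th corner. -/
def subdivide (c : U → Fin 3 → V) : U × Fin 3 → Fin 3 → V ⊕ U × Fin 3 :=
  fun p j => if p.2 = j then Sum.inl (c p.1 j) else
    Sum.inr (p.1, (![![0, 2, 1], ![2, 1, 0], ![1, 0, 2]] : Fin 3 → Fin 3 → Fin 3) p.2 j)

variable [DecidableEq V] [Fintype U] [DecidableEq U] [CommRing R]

omit [DecidableEq V] in
lemma sum_ite_ite_eq {M : Type*} [AddCommMonoid M] (P : U → Prop) [DecidablePred P] (q : U)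
    (r : M) : (∑ x, if P x then (if x = q then r else 0) else 0) = if P q then r else 0 := by
  rw [Finset.sum_eq_single q] <;> simp +contextual

omit [DecidableEq V] in
lemma sum_ite_ite_eq' {M : Type*} [AddCommMonoid M] (P : U → Prop) [DecidablePred P] (q : U)
    (r : M) : (∑ x, if P x then (if q = x then r else 0) else 0) = if P q then r else 0 := by
  simp_rw [eq_comm (a := q), sum_ite_ite_eq]

lemma cellLaplacian_apply (c : U → Fin 3 → V) (u v : V) :
    cellLaplacian R c u v = ∑ p, ∑ i, ∑ j,
      if c p i = u ∧ c p j = v then twoValued (2 : R) (-1) i j else 0 := by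
  simp only [cellLaplacian, Matrix.mul_apply, Fintype.sum_prod_type, Matrix.kroneckerMap_apply,
    Matrix.one_apply, cornerIncidence, Matrix.of_apply, Matrix.transpose_apply, Finset.sum_mul]
  refine Finset.sum_congr rfl fun p _ => ?_
  rw [Finset.sum_comm]
  simp only [ite_mul, one_mul, zero_mul, mul_ite, mul_one, mul_zero, Finset.sum_ite_irrel,
    Finset.sum_const_zero]
  rw [Finset.sum_comm]
  conv_rhs => rw [Finset.sum_comm]
  simp [ite_and, Fin.sum_univ_three]
  grind

omit [DecidableEq U] in
lemma cellDegree_apply (c : U → Fin 3 → V) (u v : V) :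
    cellDegree R c u v = ∑ p, ∑ i, if c p i = u ∧ c p i = v then 1 else 0 := by
  simp [cellDegree, Matrix.mul_apply, Fintype.sum_prod_type, cornerIncidence, ← ite_and,
    and_comm, -Finset.sum_boole]

/-- The span of the identity and the all-ones matrix is a commutative algebra. Every block attached
to a cell lies in it, so inverses and Schur complements reduce to identities between pairs of
scalars. -/
lemma twoValued_mul (a b a' b' : R) : twoValued a b * twoValued a' b' =
    twoValued (a * a' + 2 * b * b') (a * b' + b * a' + b * b') := by
  ext i j
  fin_cases i <;> fin_cases j <;>
    simp [twoValued, Matrix.mul_apply, Fin.sum_univ_three] <;> ring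

lemma twoValued_add (a b a' b' : R) : twoValued a b + twoValued a' b' =
    twoValued (a + a') (b + b') := by
  ext i j
  fin_cases i <;> fin_cases j <;> simp [twoValued]

lemma twoValued_one_zero : twoValued (1 : R) 0 = 1 := by
  ext i j
  fin_cases i <;> fin_cases j <;> simp [twoValued]

lemma det_twoValued (a b : R) : (twoValued a b).det = (a - b) ^ 2 * (a + 2 * b) := by
  simp [twoValued, Matrix.det_fin_three]
  ring

lemma twoValued_smul (r a b : R) : r • twoValued a b = twoValued (r * a) (r * b) := by
  ext i j
  fin_cases i <;> fin_cases j <;> simp [twoValued]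

lemma cellDegree_subdivide (c : U → Fin 3 → V) :
    cellDegree R (subdivide c) = Matrix.fromBlocks (cellDegree R c) 0 0 ((2 : R) • 1) := by
  ext (u | ⟨p, i⟩) (v | ⟨q, j⟩)
  · simp [cellDegree_apply, Fintype.sum_prod_type, Fin.sum_univ_three, subdivide, -Finset.sum_boole]
  · simp [cellDegree_apply, Fintype.sum_prod_type, Fin.sum_univ_three, subdivide, -Finset.sum_boole]
  · simp [cellDegree_apply, Fintype.sum_prod_type, Fin.sum_univ_three, subdivide, -Finset.sum_boole]
  · fin_cases i <;> fin_cases j <;>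
    simp [cellDegree_apply, Fintype.sum_prod_type, Fin.sum_univ_three, subdivide,
      -Finset.sum_boole, Matrix.one_apply, ite_and, Finset.sum_add_distrib]
    all_goals split_ifs <;> norm_num

/-- An old vertex keeps one small cell per old cell, whence `2 • cellDegree`; a midpoint lies in two
small cells of the same old cell, whence the diagonal entry 4. Old vertices are joined only to the
midpoints of the two adjacent sides. -/
lemma cellLaplacian_subdivide (c : U → Fin 3 → V) :
    cellLaplacian R (subdivide c) = Matrix.fromBlocks ((2 : R) • cellDegree R c)
      (-(cornerIncidence R c * ((1 : Matrix U U R) ⊗ₖ twoValued 0 1)))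
      (-(((1 : Matrix U U R) ⊗ₖ twoValued 0 1) * (cornerIncidence R c)ᵀ))
      ((1 : Matrix U U R) ⊗ₖ twoValued 4 (-1)) := by
  ext (u | ⟨p, i⟩) (v | ⟨q, j⟩)
  · simp [cellLaplacian_apply, cellDegree_apply, Fintype.sum_prod_type, Fin.sum_univ_three,
      subdivide, twoValued, -Finset.sum_boole, Finset.mul_sum, mul_add]
  · fin_cases j <;> simp [cellLaplacian_apply, Fintype.sum_prod_type, Fin.sum_univ_three,
      subdivide, twoValued, cornerIncidence, Matrix.mul_apply, Matrix.one_apply,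
      Finset.sum_add_distrib, -Finset.sum_boole, ite_and, sum_ite_ite_eq] <;>
    split_ifs <;> ring
  · fin_cases i <;> simp [cellLaplacian_apply, Fintype.sum_prod_type, Fin.sum_univ_three,
      subdivide, twoValued, cornerIncidence, Matrix.mul_apply, Matrix.one_apply,
      Finset.sum_add_distrib, -Finset.sum_boole, ite_and, sum_ite_ite_eq'] <;>
    split_ifs <;> ring
  · fin_cases i <;> fin_cases j <;>
    simp [cellLaplacian_apply, Fintype.sum_prod_type, Fin.sum_univ_three, subdivide,
      twoValued, -Finset.sum_boole, Matrix.one_apply, ite_and, Finset.sum_add_distrib] <;>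
    split_ifs <;> norm_num

variable [Fintype V]

/-- The Schur complement with respect to the midpoints. -/
theorem det_subdivide (c : U → Fin 3 → V) (α β x a b : R) (hx : x = α + 2 * β)
    (ha : (5 + x) * a = 1) (hb : (2 + x) * b = 1) :
    (α • 1 + β • cellDegree R (subdivide c) + cellLaplacian R (subdivide c)).det =
      ((5 + x) ^ 2 * (2 + x)) ^ Fintype.card U *
        (α • 1 + (β + 2 * x * b) • cellDegree R c +
          ((6 + x) * a * b) • cellLaplacian R c).det := by
  set B := cornerIncidence R c with hB
  set N : Matrix (U × Fin 3) (U × Fin 3) R := (1 : Matrix U U R) ⊗ₖ twoValued 0 1 with hN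
  -- The midpoint block: each midpoint has mass α + 2β = x because it lies in two small cells. Its
  -- eigenvalues on a cell are 5 + x (twice) and 2 + x, inverted by `a` and `b`; `M'` is the
  -- resulting inverse.
  set M : Matrix (U × Fin 3) (U × Fin 3) R :=
    (1 : Matrix U U R) ⊗ₖ twoValued (4 + x) (-1) with hM
  set M' : Matrix (U × Fin 3) (U × Fin 3) R :=
    (1 : Matrix U U R) ⊗ₖ twoValued (a + a * b) (a * b) with hM'
  have e1 : M' * M = 1 := by
    rw [hM, hM', ← Matrix.mul_kronecker_mul, twoValued_mul, ← Matrix.one_kronecker_one,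
      ← twoValued_one_zero, one_mul]
    congr 2
    · linear_combination ha + a * hb
    · linear_combination a * hb
  -- This identity closes the recursion: the correction splits into a multiple of the identity,
  -- which only changes the coefficient of D, and a multiple of the cell block of L.
  have e2 : N * M' * N = (2 - 2 * x * b) • 1 - ((6 + x) * a * b) • (1 ⊗ₖ twoValued 2 (-1)) := by
    rw [hN, hM', ← Matrix.mul_kronecker_mul, ← Matrix.mul_kronecker_mul, twoValued_mul,
      twoValued_mul, ← Matrix.one_kronecker_one, ← Matrix.kronecker_smul, ← Matrix.kronecker_smul,
      sub_eq_add_neg, ← neg_one_smul R, ← Matrix.kronecker_smul, ← Matrix.kronecker_add,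
      ← twoValued_one_zero, twoValued_smul, twoValued_smul, twoValued_smul, twoValued_add]
    simp only [one_mul]
    congr 2
    · linear_combination 2 * hb + 4 * b * ha - 2 * a * hb
    · linear_combination -a * hb
  let _ : Invertible M := ⟨M', e1, mul_eq_one_comm.mp e1⟩
  have e3 : (α • 1 + β • cellDegree R (subdivide c) + cellLaplacian R (subdivide c)) =
      Matrix.fromBlocks (α • 1 + (β + 2) • (B * Bᵀ)) (-(B * N)) (-(N * Bᵀ)) M := by
    rw [cellDegree_subdivide, cellLaplacian_subdivide, ← Matrix.fromBlocks_one,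
      Matrix.fromBlocks_smul, Matrix.fromBlocks_smul, Matrix.fromBlocks_add, Matrix.fromBlocks_add]
    congr 1
    · rw [add_smul, add_assoc]; rfl
    · simp [hB, hN]
    · simp [hB, hN]
    · rw [hM, smul_smul, ← add_smul, ← Matrix.one_kronecker_one, ← Matrix.kronecker_smul,
        ← Matrix.kronecker_add, ← twoValued_one_zero, twoValued_smul, twoValued_add]
      congr 2
      · rw [hx]; ring
      · ring
  have e5 : M.det = ((5 + x) ^ 2 * (2 + x)) ^ Fintype.card U := by
    rw [hM, Matrix.det_kronecker, det_twoValued, Matrix.det_one, one_pow, one_mul]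
    congr 1; ring
  rw [e3, Matrix.det_fromBlocks₂₂, e5]
  congr 1
  have e4 : -(B * N) * ⅟M * -(N * Bᵀ) = B * (N * M' * N) * Bᵀ := by
    change -(B * N) * M' * -(N * Bᵀ) = _
    simp only [Matrix.mul_assoc, Matrix.neg_mul, Matrix.mul_neg, neg_neg]
  rw [e4, e2, cellDegree, cellLaplacian, ← hB]
  simp only [Matrix.mul_sub, Matrix.sub_mul, Matrix.mul_smul, Matrix.smul_mul, Matrix.mul_one]
  congr 1
  module

end Cells

/-! ### The gasket as an iterated subdivision -/

/-- The position of the `j`-th corner of an upward pointing triangle, relative to its lower left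
corner. -/
def cornerOffset : Fin 3 → ℕ × ℕ := ![(0, 0), (1, 0), (0, 1)]

lemma corners_eq_image (p : ℕ × ℕ) : corners p = Finset.univ.image fun j => p + cornerOffset j := by
  ext v
  simp [corners, cornerOffset, Prod.ext_iff, Fin.exists_fin_succ]
  grind

/-- The corners of the upward pointing triangles, as vertices of the gasket. -/
def gasketCell (n : ℕ) (p : upTriangles n) (j : Fin 3) : gasketVertices n :=
  ⟨p + cornerOffset j, Finset.mem_biUnion.2 ⟨p, p.2, by simp [corners_eq_image]⟩⟩

lemma exists_gasketCell {n : ℕ} (v : gasketVertices n) : ∃ p j, gasketCell n p j = v := by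
  obtain ⟨p, hp, hv⟩ := Finset.mem_biUnion.1 v.2
  rw [corners_eq_image] at hv
  obtain ⟨j, -, hj⟩ := Finset.mem_image.1 hv
  exact ⟨⟨p, hp⟩, j, Subtype.ext hj⟩

lemma mem_upTriangles_succ {n : ℕ} {q : ℕ × ℕ} :
    q ∈ upTriangles (n + 1) ↔ ∃ p ∈ upTriangles n, ∃ i, q = 2 • p + cornerOffset i := by
  simp [upTriangles, cornerOffset, Fin.exists_fin_succ, Prod.ext_iff]

/-- The upward pointing triangles of the next gasket. -/
noncomputable def upTrianglesEquiv (n : ℕ) : upTriangles n × Fin 3 ≃ upTriangles (n + 1) :=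
  Equiv.ofBijective (fun p => ⟨2 • p.1.1 + cornerOffset p.2,
    mem_upTriangles_succ.2 ⟨_, p.1.2, _, rfl⟩⟩) <| by
    constructor
    · rintro ⟨⟨⟨a, b⟩, hp⟩, i⟩ ⟨⟨⟨a', b'⟩, hq⟩, j⟩ h
      have h := congrArg Subtype.val h
      fin_cases i <;> fin_cases j <;>
        simp [cornerOffset, Prod.ext_iff] at h ⊢ <;> omega
    · rintro ⟨q, hq⟩
      obtain ⟨p, hp, i, rfl⟩ := mem_upTriangles_succ.1 hq
      exact ⟨(⟨p, hp⟩, i), rfl⟩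

/-- The position of a vertex of the subdivided gasket. -/
def subdivisionPosition {n : ℕ} : gasketVertices n ⊕ upTriangles n × Fin 3 → ℕ × ℕ :=
  Sum.elim (fun v => 2 • v.1)
    fun p => 2 • p.1.1 + (![(1, 1), (0, 1), (1, 0)] : Fin 3 → ℕ × ℕ) p.2

lemma subdivisionPosition_subdivide {n : ℕ} (p : upTriangles n × Fin 3) (j : Fin 3) :
    subdivisionPosition (subdivide (gasketCell n) p j) =
      (gasketCell (n + 1) (upTrianglesEquiv n p) j).1 := by
  obtain ⟨⟨⟨a, b⟩, hp⟩, i⟩ := p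
  fin_cases i <;> fin_cases j <;>
    simp [cornerOffset, subdivisionPosition, subdivide, gasketCell, upTrianglesEquiv,
      Prod.ext_iff] <;> omega

lemma exists_subdivide {U V : Type*} {c : U → Fin 3 → V} (hc : ∀ v, ∃ p j, c p j = v)
    (v : V ⊕ U × Fin 3) : ∃ p j, subdivide c p j = v := by
  rcases v with v | ⟨p, k⟩
  · obtain ⟨p, j, rfl⟩ := hc v
    exact ⟨(p, j), j, by simp [subdivide]⟩
  · fin_cases k
    · exact ⟨(p, 1), 2, by simp [subdivide]⟩
    · exact ⟨(p, 0), 2, by simp [subdivide]⟩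
    · exact ⟨(p, 0), 1, by simp [subdivide]⟩

/-- The vertices of the next gasket. -/
noncomputable def gasketVerticesEquiv (n : ℕ) :
    gasketVertices n ⊕ upTriangles n × Fin 3 ≃ gasketVertices (n + 1) :=
  Equiv.ofBijective (fun v => ⟨subdivisionPosition v, by
    obtain ⟨p, j, rfl⟩ := exists_subdivide exists_gasketCell v
    rw [subdivisionPosition_subdivide]
    exact Subtype.prop _⟩) <| by
    constructor
    -- Parity separates the cases: old vertices have two even coordinates, and the parities of a
    -- midpoint reveal which side it bisects.
    · rintro (⟨⟨a, b⟩, hp⟩ | ⟨⟨⟨a, b⟩, hp⟩, i⟩) (⟨⟨a', b'⟩, hq⟩ | ⟨⟨⟨a', b'⟩, hq⟩, j⟩) h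
      · have h := congrArg Subtype.val h
        simp [subdivisionPosition, Prod.ext_iff] at h ⊢; omega
      · have h := congrArg Subtype.val h
        fin_cases j <;> simp [subdivisionPosition, Prod.ext_iff] at h ⊢ <;> omega
      · have h := congrArg Subtype.val h
        fin_cases i <;> simp [subdivisionPosition, Prod.ext_iff] at h ⊢ <;> omega
      · have h := congrArg Subtype.val h
        fin_cases i <;> fin_cases j <;> simp [subdivisionPosition, Prod.ext_iff] at h ⊢ <;> omega
    · intro v
      obtain ⟨q, j, rfl⟩ := exists_gasketCell v
      obtain ⟨p, rfl⟩ := (upTrianglesEquiv n).surjective q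
      exact ⟨subdivide (gasketCell n) p j, Subtype.ext (subdivisionPosition_subdivide p j)⟩

lemma gasketVerticesEquiv_subdivide {n : ℕ} (p : upTriangles n × Fin 3) (j : Fin 3) :
    gasketVerticesEquiv n (subdivide (gasketCell n) p j) =
      gasketCell (n + 1) (upTrianglesEquiv n p) j :=
  Subtype.ext (subdivisionPosition_subdivide p j)

lemma card_upTriangles (n : ℕ) : Fintype.card (upTriangles n) = 3 ^ n := by
  induction n with
  | zero => simp [upTriangles]
  | succ n ih =>
    rw [← Fintype.card_congr (upTrianglesEquiv n), Fintype.card_prod, ih]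
    simp [pow_succ]

lemma two_mul_card_gasketVertices (n : ℕ) :
    2 * Fintype.card (gasketVertices n) = 3 ^ (n + 1) + 3 := by
  induction n with
  | zero => rw [Fintype.card_coe]; decide
  | succ n ih =>
    rw [← Fintype.card_congr (gasketVerticesEquiv n), Fintype.card_sum, Fintype.card_prod,
      card_upTriangles, mul_add, ih, Fintype.card_fin]
    ring

/-! ### Invariance under relabelling of cells and vertices -/

section Transport

variable {R : Type*} [CommRing R] {U V U' V' : Type*} [Fintype U] [DecidableEq U] [DecidableEq V]
  [Fintype U'] [DecidableEq U'] [DecidableEq V'] {c : U → Fin 3 → V} {c' : U' → Fin 3 → V'}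
  (f : U ≃ U') (e : V ≃ V')

include f in
lemma cellLaplacian_submatrix (h : ∀ p j, e (c p j) = c' (f p) j) :
    (cellLaplacian R c').submatrix e e = cellLaplacian R c := by
  ext u v
  simp only [Matrix.submatrix_apply, cellLaplacian_apply]
  rw [← f.sum_comp]
  simp [← h]

include f in
omit [DecidableEq U] [DecidableEq U'] in
lemma cellDegree_submatrix (h : ∀ p j, e (c p j) = c' (f p) j) :
    (cellDegree R c').submatrix e e = cellDegree R c := by
  ext u v
  simp only [Matrix.submatrix_apply, cellDegree_apply]
  rw [← f.sum_comp]
  simp [← h]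

end Transport

lemma det_gasket_succ {R : Type*} [CommRing R] (n : ℕ) (α β x a b : R) (hx : x = α + 2 * β)
    (ha : (5 + x) * a = 1) (hb : (2 + x) * b = 1) :
    (α • 1 + β • cellDegree R (gasketCell (n + 1)) + cellLaplacian R (gasketCell (n + 1))).det =
      ((5 + x) ^ 2 * (2 + x)) ^ 3 ^ n *
        (α • 1 + (β + 2 * x * b) • cellDegree R (gasketCell n) +
          ((6 + x) * a * b) • cellLaplacian R (gasketCell n)).det := by
  rw [← card_upTriangles n, ← det_subdivide (gasketCell n) α β x a b hx ha hb,
    ← cellDegree_submatrix (upTrianglesEquiv n) (gasketVerticesEquiv n)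
      gasketVerticesEquiv_subdivide,
    ← cellLaplacian_submatrix (upTrianglesEquiv n) (gasketVerticesEquiv n)
      gasketVerticesEquiv_subdivide,
    ← Matrix.det_submatrix_equiv_self (gasketVerticesEquiv n)]
  simp [Matrix.submatrix_add, Matrix.submatrix_smul]

/-! ### The Laplacian matrix of the gasket -/

lemma cellLaplacian_row_sum {R : Type*} [CommRing R] {U V : Type*} [Fintype U] [DecidableEq U]
    [Fintype V] [DecidableEq V] (c : U → Fin 3 → V) (u : V) : ∑ v, cellLaplacian R c u v = 0 := by
  simp only [cellLaplacian_apply]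
  rw [Finset.sum_comm]
  refine Finset.sum_eq_zero fun p _ => ?_
  rw [Finset.sum_comm]
  refine Finset.sum_eq_zero fun i _ => ?_
  rw [Finset.sum_comm]
  by_cases h : c p i = u
  · simp only [h, true_and, Finset.sum_ite_eq, Finset.mem_univ, if_true]
    fin_cases i <;> simp [Fin.sum_univ_three, twoValued] <;> norm_num
  · simp [h]

lemma trace_cellLaplacian {R : Type*} [CommRing R] {U V : Type*} [Fintype U] [DecidableEq U]
    [Fintype V] [DecidableEq V] (c : U → Fin 3 → V) (hc : ∀ p, Function.Injective (c p)) :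
    (cellLaplacian R c).trace = 6 * Fintype.card U := by
  simp only [Matrix.trace, Matrix.diag, cellLaplacian_apply]
  rw [Finset.sum_comm]
  have h (p : U) : ∑ v, ∑ i, ∑ j, (if c p i = v ∧ c p j = v then twoValued (2 : R) (-1) i j else 0)
      = 6 := by
    rw [Finset.sum_comm]
    simp_rw [Finset.sum_comm (s := (Finset.univ : Finset V)), ite_and]
    simp only [Finset.sum_ite_eq, Finset.mem_univ, if_true, (hc p).eq_iff]
    simp [Fin.sum_univ_three, twoValued]
    norm_num
  simp [h, mul_comm]

/-- The difference of two distinct corners determines which corners they are, and then the cell. So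
each edge lies in one cell only, and off-diagonal Laplacian entries are not counted twice. -/
lemma gasketCell_inj {n : ℕ} {p q : upTriangles n} {i j i' j' : Fin 3} (h : i ≠ j)
    (h1 : gasketCell n q i' = gasketCell n p i) (h2 : gasketCell n q j' = gasketCell n p j) :
    q = p ∧ i' = i ∧ j' = j := by
  obtain ⟨⟨a, b⟩, hp⟩ := p
  obtain ⟨⟨a', b'⟩, hq⟩ := q
  fin_cases i <;> fin_cases j <;> try exact (h rfl).elim
  all_goals fin_cases i' <;> fin_cases j' <;>
    simp [gasketCell, cornerOffset] at h1 h2 ⊢ <;> omega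

lemma gasketCell_injective {n : ℕ} (p : upTriangles n) : Function.Injective (gasketCell n p) := by
  obtain ⟨⟨a, b⟩, hp⟩ := p
  intro i j h
  fin_cases i <;> fin_cases j <;> simp [gasketCell, cornerOffset] at h ⊢

lemma gasket_adj_iff {n : ℕ} {u v : gasketVertices n} :
    (gasket n).Adj u v ↔ ∃ p i j, i ≠ j ∧ gasketCell n p i = u ∧ gasketCell n p j = v := by
  constructor
  · rintro ⟨huv, p, hp, hu, hv⟩
    rw [corners_eq_image] at hu hv
    obtain ⟨i, -, hi⟩ := Finset.mem_image.1 hu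
    obtain ⟨j, -, hj⟩ := Finset.mem_image.1 hv
    refine ⟨⟨p, hp⟩, i, j, ?_, Subtype.ext hi, Subtype.ext hj⟩
    rintro rfl
    exact huv (Subtype.ext (hi.symm.trans hj))
  · rintro ⟨p, i, j, hij, rfl, rfl⟩
    refine ⟨fun h => hij (gasketCell_injective p h), p, p.2, ?_, ?_⟩ <;>
      simp [corners_eq_image, gasketCell]

lemma lapMatrix_gasket_apply_of_ne {n : ℕ} {u v : gasketVertices n} (huv : u ≠ v) :
    (gasket n).lapMatrix ℝ u v = cellLaplacian ℝ (gasketCell n) u v := by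
  rw [SimpleGraph.lapMatrix, Matrix.sub_apply, SimpleGraph.degMatrix,
    Matrix.diagonal_apply_ne _ huv, SimpleGraph.adjMatrix_apply, cellLaplacian_apply]
  by_cases h : (gasket n).Adj u v
  · obtain ⟨p, i, j, hij, rfl, rfl⟩ := gasket_adj_iff.1 h
    rw [if_pos h, Finset.sum_eq_single p, Finset.sum_eq_single i, Finset.sum_eq_single j,
      if_pos ⟨rfl, rfl⟩]
    · fin_cases i <;> fin_cases j <;> simp [twoValued] at hij ⊢
    · exact fun j' _ hj => if_neg fun hh => hj (gasketCell_inj hij hh.1 hh.2).2.2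
    · simp
    · exact fun i' _ hi => Finset.sum_eq_zero fun j' _ =>
        if_neg fun hh => hi (gasketCell_inj hij hh.1 hh.2).2.1
    · simp
    · exact fun q _ hq => Finset.sum_eq_zero fun i' _ => Finset.sum_eq_zero fun j' _ =>
        if_neg fun hh => hq (gasketCell_inj hij hh.1 hh.2).1
    · simp
  · rw [if_neg h, sub_zero, eq_comm]
    refine Finset.sum_eq_zero fun p _ => Finset.sum_eq_zero fun i _ => Finset.sum_eq_zero fun j _ =>
      if_neg ?_
    rintro ⟨rfl, rfl⟩
    exact h (gasket_adj_iff.2 ⟨p, i, j, fun hij => huv (by rw [hij]), rfl, rfl⟩)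

/-- Both matrices have zero row sums, so the diagonal is determined by the off-diagonal entries. -/
lemma lapMatrix_gasket (n : ℕ) : (gasket n).lapMatrix ℝ = cellLaplacian ℝ (gasketCell n) := by
  ext u v
  by_cases huv : u = v
  · subst huv
    have h1 : ∑ v, (gasket n).lapMatrix ℝ u v = 0 := by
      simpa [Matrix.mulVec, dotProduct] using
        congrFun ((gasket n).lapMatrix_mulVec_const_eq_zero (R := ℝ)) u
    have h2 := cellLaplacian_row_sum (R := ℝ) (gasketCell n) u
    rw [← Finset.add_sum_erase _ _ (Finset.mem_univ u)] at h1 h2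
    rw [Finset.sum_congr rfl fun v hv =>
      lapMatrix_gasket_apply_of_ne (Finset.ne_of_mem_erase hv).symm] at h1
    linarith
  · exact lapMatrix_gasket_apply_of_ne huv

lemma card_edgeFinset_gasket (n : ℕ) : (gasket n).edgeFinset.card = 3 ^ (n + 1) := by
  have h := trace_cellLaplacian (R := ℝ) (gasketCell n) gasketCell_injective
  rw [← lapMatrix_gasket, SimpleGraph.lapMatrix, Matrix.trace_sub, SimpleGraph.trace_adjMatrix,
    SimpleGraph.degMatrix, Matrix.trace_diagonal, ← Nat.cast_sum,
    SimpleGraph.sum_degrees_eq_twice_card_edges, card_upTriangles] at h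
  have h' : 2 * (gasket n).edgeFinset.card = 6 * 3 ^ n := by
    exact_mod_cast (sub_zero _).symm.trans h
  rw [pow_succ]
  omega

/-! ### Second order expansions of logarithms of power series -/

open PowerSeries in
/-- The logarithm of `f` is `c + a * X + b * X ^ 2 + O(X ^ 3)` for some constant `c`. -/
structure HasLogJet (f : PowerSeries ℝ) (a b : ℝ) : Prop where
  coeff_zero : coeff 0 f ≠ 0
  coeff_one : coeff 1 f = a * coeff 0 f
  coeff_two : coeff 2 f = (b + a ^ 2 / 2) * coeff 0 f

namespace HasLogJet

open PowerSeries

lemma coeff_one_mul' (f g : PowerSeries ℝ) :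
    coeff 1 (f * g) = coeff 0 f * coeff 1 g + coeff 1 f * coeff 0 g := by
  rw [coeff_mul, Finset.Nat.sum_antidiagonal_eq_sum_range_succ fun i j => coeff i f * coeff j g]
  simp [Finset.sum_range_succ]

lemma coeff_two_mul (f g : PowerSeries ℝ) :
    coeff 2 (f * g) = coeff 0 f * coeff 2 g + coeff 1 f * coeff 1 g + coeff 2 f * coeff 0 g := by
  rw [coeff_mul, Finset.Nat.sum_antidiagonal_eq_sum_range_succ fun i j => coeff i f * coeff j g]
  simp [Finset.sum_range_succ]

lemma coeff_zero_mul' (f g : PowerSeries ℝ) :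
    coeff 0 (f * g) = coeff 0 f * coeff 0 g := by simp

variable {f g : PowerSeries ℝ} {a b a' b' : ℝ}

lemma mul (hf : HasLogJet f a b) (hg : HasLogJet g a' b') :
    HasLogJet (f * g) (a + a') (b + b') where
  coeff_zero := by rw [coeff_zero_mul']; exact mul_ne_zero hf.coeff_zero hg.coeff_zero
  coeff_one := by rw [coeff_one_mul', coeff_zero_mul', hf.coeff_one, hg.coeff_one]; ring
  coeff_two := by
    rw [coeff_two_mul, coeff_zero_mul', hf.coeff_one, hg.coeff_one, hf.coeff_two, hg.coeff_two]
    ring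

lemma congr (hf : HasLogJet f a b) (ha : a = a') (hb : b = b') : HasLogJet f a' b' :=
  ha ▸ hb ▸ hf

protected lemma one : HasLogJet 1 0 0 where
  coeff_zero := by simp
  coeff_one := by simp [PowerSeries.coeff_one]
  coeff_two := by simp [PowerSeries.coeff_one]

lemma pow (hf : HasLogJet f a b) (n : ℕ) : HasLogJet (f ^ n) (n * a) (n * b) := by
  induction n with
  | zero => simpa using HasLogJet.one
  | succ n ih =>
    rw [pow_succ]
    convert ih.mul hf using 1 <;> push_cast <;> ring

lemma prod {ι : Type*} (s : Finset ι) {f : ι → PowerSeries ℝ} {a b : ι → ℝ}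
    (h : ∀ i ∈ s, HasLogJet (f i) (a i) (b i)) :
    HasLogJet (∏ i ∈ s, f i) (∑ i ∈ s, a i) (∑ i ∈ s, b i) := by
  classical
  induction s using Finset.induction_on with
  | empty => simpa using HasLogJet.one
  | insert i s hi ih =>
    rw [Finset.prod_insert hi, Finset.sum_insert hi, Finset.sum_insert hi]
    exact (h i (Finset.mem_insert_self i s)).mul
      (ih fun j hj => h j (Finset.mem_insert_of_mem hj))

lemma of_mul_eq_one (hf : HasLogJet f a b) (h : f * g = 1) : HasLogJet g (-a) (-b) := by
  have h0 := congrArg (coeff 0) h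
  have h1 := congrArg (coeff 1) h
  have h2 := congrArg (coeff 2) h
  rw [coeff_zero_mul'] at h0
  rw [coeff_one_mul', hf.coeff_one] at h1
  rw [coeff_two_mul, hf.coeff_one, hf.coeff_two] at h2
  simp only [PowerSeries.coeff_one] at h0 h1 h2
  norm_num at h0 h1 h2
  have hf0 := hf.coeff_zero
  simp only [coeff_zero_eq_constantCoeff] at hf0
  have e1 : coeff 1 g = -a * constantCoeff g := by
    apply mul_left_cancel₀ hf0
    linear_combination h1
  refine ⟨?_, ?_, ?_⟩
  · intro h'
    simp only [coeff_zero_eq_constantCoeff] at h'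
    simp [h'] at h0
  · simpa using e1
  · simp only [coeff_zero_eq_constantCoeff]
    apply mul_left_cancel₀ hf0
    rw [e1] at h2
    linear_combination h2

/-- Unlike a product, a sum needs the constant coefficient as well, since a jet leaves the constant
of the logarithm free. -/
lemma one_add {c : ℝ} (hf : HasLogJet f a b) (hc : coeff 0 f = c) (h : 1 + c ≠ 0) :
    HasLogJet (1 + f) (a * c / (1 + c))
      ((b + a ^ 2 / 2) * c / (1 + c) - (a * c / (1 + c)) ^ 2 / 2) := by
  have h1 := hf.coeff_one
  have h2 := hf.coeff_two
  rw [hc] at h1 h2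
  refine ⟨?_, ?_, ?_⟩
  · rw [map_add, hc]; simpa using h
  · rw [map_add, map_add, hc, h1]; simp [PowerSeries.coeff_one]; field_simp
  · rw [map_add, map_add, hc, h2]; simp [PowerSeries.coeff_one]; field_simp

lemma unique (hf : HasLogJet f a b) (hf' : HasLogJet f a' b') : a = a' ∧ b = b' := by
  have h1 : a = a' := mul_right_cancel₀ hf.coeff_zero (hf.coeff_one.symm.trans hf'.coeff_one)
  refine ⟨h1, ?_⟩
  have h2 := mul_right_cancel₀ hf.coeff_zero (hf.coeff_two.symm.trans hf'.coeff_two)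
  rw [h1] at h2
  linarith

lemma const_add {c c₁ c₂ : ℝ} (hc : c ≠ 0) (h0 : coeff 0 f = 0) (h1 : coeff 1 f = c₁)
    (h2 : coeff 2 f = c₂) : HasLogJet (C c + f) (c₁ / c) (c₂ / c - c₁ ^ 2 / (2 * c ^ 2)) := by
  simp only [coeff_zero_eq_constantCoeff] at h0
  refine ⟨?_, ?_, ?_⟩
  · simpa [h0] using hc
  · simp [h0, h1, hc]
  · simp [h0, h2]
    field_simp
    ring

end HasLogJet

/-! ### The characteristic determinant of the gasket -/

section Determinant

open PowerSeries

/-- A deformation of the characteristic polynomial of the Laplacian matrix, in which the mass at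
the outer corners of the gasket differs from the mass `x` at the other vertices. -/
noncomputable def massDet (n : ℕ) (x ρ : PowerSeries ℝ) : PowerSeries ℝ :=
  ((ρ * x) • (1 : Matrix _ _ (PowerSeries ℝ)) + (C (1 / 2) * (x - ρ * x)) •
    cellDegree (PowerSeries ℝ) (gasketCell n) + cellLaplacian (PowerSeries ℝ) (gasketCell n)).det

/-- Apply `det_gasket_succ` and pull the coefficient (6 + x)/((5 + x)(2 + x)) of L out of the
matrix, once per vertex. Rescaling the other two coefficients gives the new ordinary mass x(5 + x)
and the new ratio ρ(2 + x)/(6 + x). -/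
lemma massDet_succ (n : ℕ) (x ρ a b e : PowerSeries ℝ)
    (ha : (5 + x) * a = 1) (hb : (2 + x) * b = 1) (he : (6 + x) * e = 1) :
    massDet (n + 1) x ρ = ((5 + x) ^ 2 * (2 + x)) ^ 3 ^ n *
      ((6 + x) * (a * b)) ^ Fintype.card (gasketVertices n) *
        massDet n (x * (5 + x)) (ρ * ((2 + x) * e)) := by
  have hC : (2 : PowerSeries ℝ) * C (1 / 2) = 1 := by
    rw [← map_ofNat (C (R := ℝ)) 2, ← map_mul]; norm_num
  rw [massDet, det_gasket_succ n _ _ x a b _ ha hb, mul_assoc _ _ (massDet _ _ _), massDet,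
    ← Matrix.det_smul]
  · congr 2
    rw [smul_add, smul_add, smul_smul, smul_smul, mul_assoc (6 + x) a b]
    congr 3
    · linear_combination (-ρ * x) * (((5 + x) * a) * ((2 + x) * b) * he + (5 + x) * a * hb + ha)
    · linear_combination (C (1 / 2) * ρ * x) *
        (((5 + x) * a) * ((2 + x) * b) * he + (5 + x) * a * hb + ha) -
        C (1 / 2) * (6 + x) * x * b * ha - C (1 / 2) * x * hb - 2 * x * b * hC
  · linear_combination -(x - ρ * x) * hC

/-- The corners of the triangle graph. -/
noncomputable def triangleEquiv : Fin 3 ≃ gasketVertices 0 :=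
  Equiv.ofBijective (gasketCell 0 ⟨(0, 0), by simp [upTriangles]⟩) <| by
    refine ⟨gasketCell_injective _, fun v => ?_⟩
    obtain ⟨⟨p, hp⟩, j, rfl⟩ := exists_gasketCell v
    obtain rfl : p = (0, 0) := by simpa [upTriangles] using hp
    exact ⟨j, rfl⟩

/-- The triangle graph has a single cell. -/
noncomputable def unitEquivUpTriangles : Unit ≃ upTriangles 0 :=
  (Equiv.ofBijective (fun _ => ()) (by
    rw [Fintype.bijective_iff_injective_and_card, card_upTriangles]
    refine ⟨fun p q _ => ?_, by simp⟩
    exact Fintype.card_le_one_iff.1 (card_upTriangles 0).le p q)).symm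

/-- On the triangle every vertex is an outer corner, of mass μ = x(1 + ρ)/2; the eigenvalues are μ
and twice 3 + μ. -/
lemma massDet_zero (x ρ : PowerSeries ℝ) :
    massDet 0 x ρ = (C (1 / 2) * (x * (1 + ρ))) * (3 + C (1 / 2) * (x * (1 + ρ))) ^ 2 := by
  have hC : (2 : PowerSeries ℝ) * C (1 / 2) = 1 := by
    rw [← map_ofNat (C (R := ℝ)) 2, ← map_mul]; norm_num
  have h : ∀ (p : Unit) (j : Fin 3), triangleEquiv ((fun _ j => j) p j) =
      gasketCell 0 (unitEquivUpTriangles p) j := fun p j => by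
    change gasketCell 0 _ j = _
    congr 1
    exact Fintype.card_le_one_iff.1 (card_upTriangles 0).le _ _
  have hL : (cellLaplacian (PowerSeries ℝ) fun (_ : Unit) (j : Fin 3) => j) =
      twoValued 2 (-1) := by
    ext1 i j
    rw [cellLaplacian_apply]
    fin_cases i <;> fin_cases j <;> simp [Fin.sum_univ_three, twoValued]
  have hD : (cellDegree (PowerSeries ℝ) fun (_ : Unit) (j : Fin 3) => j) =
      twoValued 1 0 := by
    ext1 i j
    rw [cellDegree_apply]
    fin_cases i <;> fin_cases j <;>
      simp [Fin.sum_univ_three, twoValued, -Finset.sum_boole]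
  rw [massDet, ← Matrix.det_submatrix_equiv_self triangleEquiv]
  have e : (((ρ * x) • (1 : Matrix _ _ (PowerSeries ℝ)) + (C (1 / 2) * (x - ρ * x)) •
      cellDegree (PowerSeries ℝ) (gasketCell 0) +
        cellLaplacian (PowerSeries ℝ) (gasketCell 0)).submatrix triangleEquiv triangleEquiv) =
      twoValued (ρ * x + C (1 / 2) * (x - ρ * x) + 2) (-1) := by
    rw [Matrix.submatrix_add, Matrix.submatrix_add, Matrix.submatrix_smul, Matrix.submatrix_smul]
    simp only [Pi.add_apply, Pi.smul_apply]
    rw [cellLaplacian_submatrix unitEquivUpTriangles triangleEquiv h,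
      cellDegree_submatrix unitEquivUpTriangles triangleEquiv h, hL, hD,
      Matrix.submatrix_one_equiv, ← twoValued_one_zero, twoValued_smul, twoValued_smul,
      twoValued_add, twoValued_add]
    simp
  have e' : ρ * x + C (1 / 2) * (x - ρ * x) = C (1 / 2) * (x * (1 + ρ)) := by
    linear_combination (-ρ * x) * hC
  rw [e, det_twoValued, e']
  ring

/-- The iterates of the spectral decimation map `x ↦ x * (5 + x)`. -/
noncomputable def decimation : ℕ → PowerSeries ℝ
  | 0 => X
  | n + 1 => decimation n * (5 + decimation n)

lemma coeff_decimation (n : ℕ) : coeff 0 (decimation n) = 0 ∧ coeff 1 (decimation n) = 5 ^ n ∧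
    coeff 2 (decimation n) = (25 ^ n - 5 ^ n) / 20 := by
  induction n with
  | zero => simp [decimation, coeff_X]
  | succ n ih =>
    obtain ⟨h0, h1, h2⟩ := ih
    have e : (5 : PowerSeries ℝ) = C 5 := (map_ofNat (C (R := ℝ)) 5).symm
    rw [decimation, HasLogJet.coeff_zero_mul', HasLogJet.coeff_one_mul', HasLogJet.coeff_two_mul, e]
    simp only [map_add, h0, h1, h2]
    simp
    refine ⟨by ring, ?_⟩
    rw [show (25 : ℝ) = 5 ^ 2 by norm_num, ← pow_mul, ← pow_mul]
    ring

lemma hasLogJet_const_add_decimation {c : ℝ} (hc : c ≠ 0) (n : ℕ) :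
    HasLogJet (C c + decimation n) (5 ^ n / c)
      ((25 ^ n - 5 ^ n) / (20 * c) - 25 ^ n / (2 * c ^ 2)) := by
  obtain ⟨h0, h1, h2⟩ := coeff_decimation n
  convert HasLogJet.const_add hc h0 h1 h2 using 2
  · ring
  · rw [← pow_mul, mul_comm n 2, pow_mul]; norm_num

/-- The inverse of `c + decimation n`. -/
noncomputable def invAdd (c : ℝ) (n : ℕ) : PowerSeries ℝ := (C c + decimation n)⁻¹

lemma add_mul_invAdd {c : ℝ} (hc : c ≠ 0) (n : ℕ) : (C c + decimation n) * invAdd c n = 1 :=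
  PowerSeries.mul_inv_cancel _ (by
    have := (hasLogJet_const_add_decimation hc n).coeff_zero
    simpa only [coeff_zero_eq_constantCoeff] using this)

/-- The ratio of the mass at the outer corners, beyond that of a half vertex, after decimation. -/
noncomputable def cornerRatio : ℕ → PowerSeries ℝ
  | 0 => 1
  | n + 1 => cornerRatio n * ((C 2 + decimation n) * invAdd 6 n)

/-- The ratio is the product of (2 + x)/(6 + x) over the first `n` iterates x, whose linear
coefficients are powers of 5; the jets sum to geometric series in 5 and 25. -/
lemma hasLogJet_cornerRatio (n : ℕ) : HasLogJet (cornerRatio n) ((5 ^ n - 1) / 12)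
    (-(17 / 4320) * (25 ^ n - 1) - (5 ^ n - 1) / 240) := by
  induction n with
  | zero => simpa [cornerRatio] using HasLogJet.one
  | succ n ih =>
    have h6 := (hasLogJet_const_add_decimation (c := 6) (by norm_num) n).of_mul_eq_one
      (add_mul_invAdd (by norm_num) n)
    exact (ih.mul ((hasLogJet_const_add_decimation (c := 2) (by norm_num) n).mul h6)).congr
      (by ring) (by ring)

lemma coeff_zero_cornerRatio (n : ℕ) : coeff 0 (cornerRatio n) = 1 / 3 ^ n := by
  induction n with
  | zero => simp [cornerRatio]
  | succ n ih =>
    have h6 := congrArg (coeff 0) (add_mul_invAdd (c := 6) (by norm_num) n)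
    have h0 := (coeff_decimation n).1
    rw [HasLogJet.coeff_zero_mul', map_add, h0] at h6
    rw [cornerRatio, HasLogJet.coeff_zero_mul', HasLogJet.coeff_zero_mul', ih, map_add, h0]
    simp at h6 ⊢
    rw [pow_succ]
    have : constantCoeff (invAdd 6 n) = 1 / 6 := by linarith
    rw [this]
    ring

/-- The quotient of `decimation n` by the variable. -/
noncomputable def decimationQuotient : ℕ → PowerSeries ℝ
  | 0 => 1
  | n + 1 => decimationQuotient n * (C 5 + decimation n)

lemma decimation_eq (n : ℕ) : decimation n = X * decimationQuotient n := by
  induction n with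
  | zero => simp [decimation, decimationQuotient]
  | succ n ih =>
    rw [decimationQuotient, ← mul_assoc, ← ih, decimation, map_ofNat]

lemma hasLogJet_decimationQuotient (n : ℕ) : HasLogJet (decimationQuotient n) ((5 ^ n - 1) / 20)
    (-(25 ^ n - 1) / 2400 - (5 ^ n - 1) / 400) := by
  induction n with
  | zero => simpa [decimationQuotient] using HasLogJet.one
  | succ n ih =>
    exact (ih.mul (hasLogJet_const_add_decimation (c := 5) (by norm_num) n)).congr
      (by ring) (by ring)

lemma coeff_zero_decimationQuotient (n : ℕ) : coeff 0 (decimationQuotient n) = 5 ^ n := by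
  rw [← (coeff_decimation n).2.1, decimation_eq]
  simp [coeff_succ_X_mul]

lemma card_gasketVertices (n : ℕ) :
    (Fintype.card (gasketVertices n) : ℝ) = (3 ^ (n + 1) + 3) / 2 := by
  have : (2 * Fintype.card (gasketVertices n) : ℝ) = 3 ^ (n + 1) + 3 := by
    exact_mod_cast two_mul_card_gasketVertices n
  linarith

/-- The starting iterate `m` is left free because one step down in `n` advances it by one. The
factor `f` collects the scalars of all steps, and its jet solves the recursion in (m, n) that they
generate. -/
lemma massDet_decimation (m n : ℕ) : ∃ f : PowerSeries ℝ,
    HasLogJet f (5 ^ m * (1 / 5 - 3 ^ n / 20 - 3 * 5 ^ n / 20))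
      (25 ^ m * (59 / 7200 * 25 ^ n - 3 ^ n / 600 - 47 / 7200)
        - 5 ^ m * (1 / 5 - 3 ^ n / 20 - 3 * 5 ^ n / 20) / 20) ∧
    massDet n (decimation m) (cornerRatio m) =
      f * massDet 0 (decimation (m + n)) (cornerRatio (m + n)) := by
  induction n generalizing m with
  | zero => exact ⟨1, by convert HasLogJet.one using 1 <;> norm_num, by simp⟩
  | succ n ih =>
    obtain ⟨f, hf, h⟩ := ih (m + 1)
    have h2 := hasLogJet_const_add_decimation (c := 2) (by norm_num) m
    have h5 := hasLogJet_const_add_decimation (c := 5) (by norm_num) m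
    have h6 := hasLogJet_const_add_decimation (c := 6) (by norm_num) m
    have i2 := add_mul_invAdd (c := 2) (by norm_num) m
    have i5 := add_mul_invAdd (c := 5) (by norm_num) m
    have i6 := add_mul_invAdd (c := 6) (by norm_num) m
    have h' := ((((h5.pow 2).mul h2).pow (3 ^ n)).mul ((h6.mul ((h5.of_mul_eq_one i5).mul
      (h2.of_mul_eq_one i2))).pow (Fintype.card (gasketVertices n)))).mul hf
    refine ⟨_, h'.congr ?_ ?_, ?_⟩
    · rw [card_gasketVertices]; push_cast; ring
    · rw [card_gasketVertices]; push_cast; ring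
    · have step := massDet_succ n (decimation m) (cornerRatio m) _ _ _ i5 i2 i6
      rw [step, show m + (n + 1) = m + 1 + n by ring, mul_assoc _ f, ← h, decimation, cornerRatio]
      simp only [map_ofNat]

/-- The sum of the reciprocals of the nonzero Laplacian eigenvalues of the gasket, where `t = 3 ^ n`
and `f = 5 ^ n`. -/
noncomputable def reciprocalSum (t f : ℝ) : ℝ :=
  (1 / 5 - t / 20 - 3 * f / 20) + (f - 1) / 20 + (f - 1) / (12 * (t + 1)) + (1 + 1 / t) * f / 3

/-- The sum of the reciprocals of the squares of the nonzero Laplacian eigenvalues of the gasket,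
where `t = 3 ^ n` and `f = 5 ^ n`. -/
noncomputable def reciprocalSqSum (t f : ℝ) : ℝ :=
  -2 * ((59 / 7200 * f ^ 2 - t / 600 - 47 / 7200) - (1 / 5 - t / 20 - 3 * f / 20) / 20
    + (-(f ^ 2 - 1) / 2400 - (f - 1) / 400)
    + ((-(17 / 4320) * (f ^ 2 - 1) - (f - 1) / 240 + ((f - 1) / 12) ^ 2 / 2) / (t + 1)
      - ((f - 1) / (12 * (t + 1))) ^ 2 / 2)
    + 2 * (((f - 1) / 20 + (f - 1) / (12 * (t + 1))) * ((1 + 1 / t) * f / 2) / 3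
      - ((1 + 1 / t) * f / 2) ^ 2 / 18))

lemma massDet_X_one (n : ℕ) : ∃ U : PowerSeries ℝ, massDet n X 1 = X * U ∧
    HasLogJet U (reciprocalSum (3 ^ n) (5 ^ n)) (-(1 / 2) * reciprocalSqSum (3 ^ n) (5 ^ n)) := by
  have ht : (0 : ℝ) < 3 ^ n := by positivity
  have h25 : (25 : ℝ) ^ n = (5 ^ n) ^ 2 := by rw [← pow_mul, mul_comm, pow_mul]; norm_num
  obtain ⟨f, hf, h⟩ := massDet_decimation 0 n
  have h1 := (hasLogJet_cornerRatio n).one_add (coeff_zero_cornerRatio n) (by positivity)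
  have hc : HasLogJet (C (1 / 2)) 0 0 := by
    refine ⟨by simp, ?_, ?_⟩ <;> simp [coeff_C]
  have hZ := hc.mul ((hasLogJet_decimationQuotient n).mul h1)
  set Z := C (1 / 2) * (decimationQuotient n * (1 + cornerRatio n)) with hZdef
  have hZ0 : coeff 0 Z = (1 + 1 / 3 ^ n) * 5 ^ n / 2 := by
    rw [hZdef, HasLogJet.coeff_zero_mul', HasLogJet.coeff_zero_mul', map_add,
      coeff_zero_decimationQuotient, coeff_zero_cornerRatio]
    simp
    ring
  have e0 : coeff 0 (X * Z) = 0 := by simp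
  have e1 : coeff 1 (X * Z) = coeff 0 Z := coeff_succ_X_mul 0 Z
  have e2 : coeff 2 (X * Z) = coeff 1 Z := coeff_succ_X_mul 1 Z
  rw [hZ.coeff_one] at e2
  have h3 := (HasLogJet.const_add (c := 3) (by norm_num) e0 e1 e2).pow 2
  -- The corner mass of the final triangle is X·Z with Z(0) ≠ 0, so the triangle determinant (X·Z)(3
  -- + X·Z)² contributes exactly one factor X.
  refine ⟨f * (Z * (C 3 + X * Z) ^ 2), ?_, (hf.mul (hZ.mul h3)).congr ?_ ?_⟩
  · have : C (1 / 2) * (decimation n * (1 + cornerRatio n)) = X * Z := by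
      rw [decimation_eq, hZdef]; ring
    simp only [decimation, cornerRatio, zero_add, massDet_zero, this] at h
    rw [h, map_ofNat]
    ring
  · rw [hZ0, reciprocalSum]
    push_cast
    field_simp
    ring
  · rw [hZ0, reciprocalSqSum, h25]
    push_cast
    field_simp
    ring

end Determinant

/-! ### Sums over the Laplacian spectrum of the gasket -/

section Spectrum

open PowerSeries

/-- At ρ = 1 all masses equal X, so this is the characteristic polynomial at -X up to the sign
(-1)^N. -/
lemma massDet_X_one_eq_prod (n : ℕ) :
    massDet n X 1 = ∏ i, (X + C (lapEigenvalues (gasket n) i)) := by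
  have hL := ((gasket n).posSemidef_lapMatrix ℝ).isHermitian.charpoly_eq
  have h1 := congrArg (fun p => Polynomial.eval₂ (C (R := ℝ)) (-X) p) hL
  simp only [Polynomial.eval₂_eq_eval_map, ← Matrix.charpoly_map, Matrix.eval_charpoly] at h1
  have e : massDet n X 1 = (-(Matrix.scalar _ (-X : PowerSeries ℝ) -
      ((gasket n).lapMatrix ℝ).map (C (R := ℝ)))).det := by
    rw [massDet]
    congr 1
    have : ((gasket n).lapMatrix ℝ).map (C (R := ℝ)) =
        cellLaplacian (PowerSeries ℝ) (gasketCell n) := by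
      rw [lapMatrix_gasket]
      ext1 u v
      have h (i j : Fin 3) : C (R := ℝ) (twoValued 2 (-1) i j) = twoValued 2 (-1) i j := by
        fin_cases i <;> fin_cases j <;> simp [twoValued, map_ofNat (C (R := ℝ)) 2]
      simp only [Matrix.map_apply, cellLaplacian_apply, map_sum, apply_ite (C (R := ℝ)),
        map_zero, h]
    rw [this]
    have h : (Matrix.scalar (gasketVertices n)) (-X : PowerSeries ℝ) =
        -((X : PowerSeries ℝ) • 1) := by
      rw [Matrix.smul_one_eq_diagonal, Matrix.diagonal_neg]
      rfl
    rw [h, one_mul, sub_self, mul_zero, zero_smul, add_zero]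
    abel
  rw [e, Matrix.det_neg, h1, Polynomial.map_prod, Polynomial.eval_prod, ← Finset.card_univ,
    ← Finset.prod_const, ← Finset.prod_mul_distrib]
  refine Finset.prod_congr rfl fun i _ => ?_
  simp [lapEigenvalues]
  ring

/-- The Laplacian matrix of the gasket has a single zero eigenvalue. -/
lemma gasket_spectrum (n : ℕ) : (∃ i₀, ∀ i, lapEigenvalues (gasket n) i = 0 ↔ i = i₀) ∧
    ∑ i with lapEigenvalues (gasket n) i ≠ 0, 1 / lapEigenvalues (gasket n) i =
      reciprocalSum (3 ^ n) (5 ^ n) ∧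
    ∑ i with lapEigenvalues (gasket n) i ≠ 0, 1 / lapEigenvalues (gasket n) i ^ 2 =
      reciprocalSqSum (3 ^ n) (5 ^ n) := by
  obtain ⟨U, hU, hj⟩ := massDet_X_one n
  set ev := lapEigenvalues (gasket n) with hev
  have hnz : HasLogJet (∏ i with ev i ≠ 0, (X + C (ev i))) (∑ i with ev i ≠ 0, 1 / ev i)
      (∑ i with ev i ≠ 0, -(1 / 2) * (1 / ev i ^ 2)) := by
    refine HasLogJet.prod _ fun i hi => ?_
    have hi : ev i ≠ 0 := (Finset.mem_filter.1 hi).2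
    rw [add_comm]
    refine (HasLogJet.const_add hi (coeff_zero_X) (coeff_one_X) (c₂ := 0)
      (by simp [coeff_X])).congr rfl ?_
    field_simp
    ring
  have hprod := massDet_X_one_eq_prod n
  rw [hU, ← Finset.prod_filter_mul_prod_filter_not _ fun i => ev i ≠ 0] at hprod
  set Q := ∏ i with ev i ≠ 0, (X + C (ev i)) with hQ
  have hz : ∏ i with ¬ ev i ≠ 0, (X + C (ev i)) =
      (X : PowerSeries ℝ) ^ (Finset.univ.filter fun i => ¬ ev i ≠ 0).card := by
    rw [← Finset.prod_const]
    refine Finset.prod_congr rfl fun i hi => ?_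
    have hi : ev i = 0 := not_not.1 (Finset.mem_filter.1 hi).2
    simp [hi]
  rw [← hev, hz] at hprod
  -- The multiplicity of 0 is the order of vanishing at X = 0: multiplicity zero would make X divide
  -- `Q`, and multiplicity at least two would make X divide `U`, but both have nonzero constant
  -- term.
  have hcard : (Finset.univ.filter fun i => ¬ ev i ≠ 0).card = 1 := by
    rcases hk : (Finset.univ.filter fun i => ¬ ev i ≠ 0).card with _ | _ | k
    · rw [hk, pow_zero, mul_one] at hprod
      exact (hnz.coeff_zero (by rw [← hprod]; simp)).elim
    · rfl
    · rw [hk, pow_succ', mul_left_comm] at hprod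
      have := mul_left_cancel₀ X_ne_zero hprod
      exact (hj.coeff_zero (by rw [this]; simp)).elim
  have hUQ : U = Q := by
    rw [hcard, pow_one, mul_comm] at hprod
    exact mul_right_cancel₀ X_ne_zero hprod
  rw [hUQ] at hj
  obtain ⟨h1, h2⟩ := hnz.unique hj
  refine ⟨?_, h1, ?_⟩
  · obtain ⟨i₀, hi₀⟩ := Finset.card_eq_one.1 hcard
    refine ⟨i₀, fun i => ?_⟩
    have := congrArg (i ∈ ·) hi₀
    simpa using this
  · rw [← Finset.mul_sum] at h2
    linarith

lemma firstOrderCoherence_gasket (n : ℕ) : firstOrderCoherence (gasket n) =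
    1 / (20 * 3 ^ (2 + n) * (1 + 3 ^ n) ^ 2) *
      (4 * 3 ^ n + 2 * 3 ^ (1 + 2 * n) - 3 ^ (1 + 3 * n) + 13 * 3 ^ (1 + n) * 5 ^ n
        + 4 * 5 ^ (1 + n) + 14 * 45 ^ n) := by
  rw [firstOrderCoherence, (gasket_spectrum n).2.1, card_gasketVertices, reciprocalSum]
  have ht : (0 : ℝ) < 3 ^ n := by positivity
  have e2 : (3 : ℝ) ^ (2 * n) = (3 ^ n) ^ 2 := by rw [← pow_mul, mul_comm]
  have e3 : (3 : ℝ) ^ (3 * n) = (3 ^ n) ^ 3 := by rw [← pow_mul, mul_comm]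
  have e45 : (45 : ℝ) ^ n = (3 ^ n) ^ 2 * 5 ^ n := by
    rw [← pow_mul, mul_comm n 2, pow_mul, ← mul_pow]; norm_num
  rw [e45]
  simp only [pow_add, pow_one, e2, e3]
  generalize (3 : ℝ) ^ n = t at *
  generalize (5 : ℝ) ^ n = f at *
  field_simp
  ring

lemma secondOrderCoherence_gasket (n : ℕ) : secondOrderCoherence (gasket n) =
    1 / (400 * (1 + 3 ^ n) ^ 3 * 9 ^ (2 + n)) *
      (86 * 3 ^ (1 + 4 * n) - 2 * 3 ^ (2 + 5 * n) + 754 * 3 ^ (1 + 2 * n) * 5 ^ n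
        + 568 * 3 ^ (1 + 3 * n) * 5 ^ n + 32 * 3 ^ (2 + n) * 5 ^ (1 + 2 * n) + 119 * 9 ^ n
        + 28 * 5 ^ n * 9 ^ (1 + 2 * n) + 64 * 15 ^ (1 + n) + 8 * 9 ^ (1 + 2 * n) * 25 ^ n
        + 24 * 25 ^ (1 + n) + 320 * 27 ^ n + 1237 * 225 ^ n + 394 * 675 ^ n) := by
  rw [secondOrderCoherence, (gasket_spectrum n).2.2, card_gasketVertices, reciprocalSqSum]
  have ht : (0 : ℝ) < 3 ^ n := by positivity
  have e2 : (3 : ℝ) ^ (2 * n) = (3 ^ n) ^ 2 := by rw [← pow_mul, mul_comm]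
  have e3 : (3 : ℝ) ^ (3 * n) = (3 ^ n) ^ 3 := by rw [← pow_mul, mul_comm]
  have e4 : (3 : ℝ) ^ (4 * n) = (3 ^ n) ^ 4 := by rw [← pow_mul, mul_comm]
  have e5 : (3 : ℝ) ^ (5 * n) = (3 ^ n) ^ 5 := by rw [← pow_mul, mul_comm]
  have f2 : (5 : ℝ) ^ (2 * n) = (5 ^ n) ^ 2 := by rw [← pow_mul, mul_comm]
  have g9 : (9 : ℝ) ^ n = (3 ^ n) ^ 2 := by rw [← e2, pow_mul]; norm_num
  have g99 : (9 : ℝ) ^ (2 * n) = (3 ^ n) ^ 4 := by rw [mul_comm, pow_mul, g9]; ring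
  have g25 : (25 : ℝ) ^ n = (5 ^ n) ^ 2 := by rw [← f2, pow_mul]; norm_num
  have g15 : (15 : ℝ) ^ n = 3 ^ n * 5 ^ n := by rw [← mul_pow]; norm_num
  have g27 : (27 : ℝ) ^ n = (3 ^ n) ^ 3 := by rw [← e3, pow_mul]; norm_num
  have g225 : (225 : ℝ) ^ n = (3 ^ n) ^ 2 * (5 ^ n) ^ 2 := by
    rw [← g9, ← g25, ← mul_pow]; norm_num
  have g675 : (675 : ℝ) ^ n = (3 ^ n) ^ 3 * (5 ^ n) ^ 2 := by
    rw [← g27, ← g25, ← mul_pow]; norm_num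
  simp only [pow_add, pow_one, e2, e3, e4, e5, f2, g9, g99, g25, g15, g27, g225, g675]
  generalize (3 : ℝ) ^ n = t at *
  generalize (5 : ℝ) ^ n = f at *
  field_simp
  ring

end Spectrum

/-! ### Asymptotics of the coherences -/

section Scaling

lemma tendsto_inv_three_pow : Tendsto (fun n : ℕ => ((3 : ℝ) ^ n)⁻¹) atTop (𝓝 0) :=
  tendsto_inv_atTop_zero.comp (tendsto_pow_atTop_atTop_of_one_lt (by norm_num))

lemma tendsto_inv_five_pow : Tendsto (fun n : ℕ => ((5 : ℝ) ^ n)⁻¹) atTop (𝓝 0) :=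
  tendsto_inv_atTop_zero.comp (tendsto_pow_atTop_atTop_of_one_lt (by norm_num))

lemma tendsto_three_pow_div_five_pow :
    Tendsto (fun n : ℕ => (3 : ℝ) ^ n / 5 ^ n) atTop (𝓝 0) := by
  simp_rw [← div_pow]
  exact tendsto_pow_atTop_nhds_zero_of_lt_one (by norm_num) (by norm_num)

/-- Since 2N/3 = 3^n + 1 and 3^(log₃ m) = m, the quotient of both sides is (1 + 3^(-n))^(log₃ m -
1). -/
lemma isEquivalent_card_rpow (m : ℕ) (hm : 0 < m) :
    (fun n : ℕ => (2 / 3 * (Fintype.card (gasketVertices n) : ℝ)) ^ (Real.logb 3 m - 1)) ~[atTop]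
      fun n : ℕ => (m : ℝ) ^ n / 3 ^ n := by
  have hm' : (0 : ℝ) < m := by exact_mod_cast hm
  rw [isEquivalent_iff_tendsto_one (Eventually.of_forall fun n => by positivity)]
  have h1 : Tendsto (fun n : ℕ => (1 + ((3 : ℝ) ^ n)⁻¹) ^ (Real.logb 3 m - 1)) atTop (𝓝 1) := by
    have := (tendsto_inv_three_pow.const_add 1).rpow_const (p := Real.logb 3 m - 1) (by simp)
    simpa using this
  refine h1.congr fun n => ?_
  have ht : (0 : ℝ) < 3 ^ n := by positivity
  have e1 : (2 / 3 * (Fintype.card (gasketVertices n) : ℝ)) = (1 + ((3 : ℝ) ^ n)⁻¹) * 3 ^ n := by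
    rw [card_gasketVertices, pow_succ (3 : ℝ) n]
    field_simp
  have e2 : ((3 : ℝ) ^ n) ^ (Real.logb 3 m - 1) = m ^ n / 3 ^ n := by
    rw [← Real.rpow_natCast, ← Real.rpow_mul (by norm_num), mul_comm, Real.rpow_mul (by norm_num),
      Real.rpow_sub (by norm_num), Real.rpow_logb (by norm_num) (by norm_num) hm', Real.rpow_one,
      Real.rpow_natCast, Real.rpow_natCast, div_pow]
  simp only [Pi.div_apply]
  rw [e1, Real.mul_rpow (by positivity) ht.le, e2]
  have : (m : ℝ) ^ n / 3 ^ n ≠ 0 := by positivity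
  field_simp

lemma isEquivalent_firstOrderCoherence :
    (fun n : ℕ => firstOrderCoherence (gasket n)) ~[atTop]
      fun n : ℕ => 7 / 90 * ((5 : ℝ) ^ n / 3 ^ n) := by
  rw [isEquivalent_iff_tendsto_one (Eventually.of_forall fun n => by positivity)]
  have ha := tendsto_inv_three_pow
  have hb := tendsto_inv_five_pow
  have hc := tendsto_three_pow_div_five_pow
  have h := (((((ha.mul hb).const_mul 4).add (hb.const_mul 6)).sub (hc.const_mul 3)).add
    (ha.const_mul 39)).add ((ha.pow 2).const_mul 20) |>.add_const 14 |>.div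
      (((ha.const_add 1).pow 2).const_mul 14) (by norm_num)
  norm_num at h
  refine h.congr fun n => ?_
  have ht : (0 : ℝ) < 3 ^ n := by positivity
  have hf : (0 : ℝ) < 5 ^ n := by positivity
  simp only [Pi.div_apply]
  rw [firstOrderCoherence, (gasket_spectrum n).2.1, card_gasketVertices, reciprocalSum,
    pow_succ (3 : ℝ) n]
  generalize (3 : ℝ) ^ n = t at *
  generalize (5 : ℝ) ^ n = f at *
  field_simp
  ring

lemma isEquivalent_secondOrderCoherence :
    (fun n : ℕ => secondOrderCoherence (gasket n)) ~[atTop]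
      fun n : ℕ => 1 / 450 * ((25 : ℝ) ^ n / 3 ^ n) := by
  rw [isEquivalent_iff_tendsto_one (Eventually.of_forall fun n => by positivity)]
  have ha := tendsto_inv_three_pow
  have hb := tendsto_inv_five_pow
  have hc := tendsto_three_pow_div_five_pow
  -- The ratio, rewritten in 3^(-n), 5^(-n) and (3/5)^n, all of which tend to 0; its value at the
  -- origin is 72/72.
  have h : ContinuousAt (fun p : ℝ × ℝ × ℝ =>
      (258 * p.2.1 ^ 2 - 18 * p.2.2 * p.2.1 + 2262 * p.1 ^ 2 * p.2.1 + 1704 * p.1 * p.2.1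
        + 1440 * p.1 ^ 3 + 119 * p.1 ^ 2 * p.2.1 ^ 2 + 252 * p.2.1 + 960 * p.1 ^ 3 * p.2.1
        + 72 + 600 * p.1 ^ 4 + 320 * p.1 * p.2.1 ^ 2 + 1237 * p.1 ^ 2 + 394 * p.1) /
          (72 * (1 + p.1) ^ 3)) (0, 0, 0) :=
    ContinuousAt.div (by fun_prop) (by fun_prop) (by norm_num)
  have h := h.tendsto.comp (ha.prodMk_nhds (hb.prodMk_nhds hc))
  norm_num [Function.comp_def] at h
  refine h.congr fun n => ?_
  have g25 : (25 : ℝ) ^ n = (5 ^ n) ^ 2 := by rw [← pow_mul, mul_comm, pow_mul]; norm_num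
  have ht : (0 : ℝ) < 3 ^ n := by positivity
  have hf : (0 : ℝ) < 5 ^ n := by positivity
  simp only [Pi.div_apply]
  rw [secondOrderCoherence, (gasket_spectrum n).2.2, card_gasketVertices, reciprocalSqSum,
    pow_succ (3 : ℝ) n,
    g25]
  generalize (3 : ℝ) ^ n = t at *
  generalize (5 : ℝ) ^ n = f at *
  field_simp
  ring

lemma card_isLittleO_secondOrderCoherence :
    (fun n : ℕ => (Fintype.card (gasketVertices n) : ℝ)) =o[atTop]
      fun n : ℕ => secondOrderCoherence (gasket n) := by
  refine IsLittleO.trans_isTheta ?_ isEquivalent_secondOrderCoherence.symm.isTheta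
  rw [isLittleO_iff_tendsto' (Eventually.of_forall fun n h => absurd h (by positivity))]
  have hb := tendsto_inv_five_pow
  have hc := tendsto_three_pow_div_five_pow
  have h := ((hc.pow 2).add (hc.mul hb)).const_mul 675
  norm_num at h
  refine h.congr fun n => ?_
  have g25 : (25 : ℝ) ^ n = (5 ^ n) ^ 2 := by rw [← pow_mul, mul_comm, pow_mul]; norm_num
  have ht : (0 : ℝ) < 3 ^ n := by positivity
  have hf : (0 : ℝ) < 5 ^ n := by positivity
  rw [card_gasketVertices, g25, pow_succ (3 : ℝ) n]
  field_simp
  ring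

end Scaling

/-! ### Integrals of processes with continuous paths -/

section ContinuousProcesses

variable {Ω : Type*} [MeasurableSpace Ω] {P : Measure Ω}

/-- A process with almost surely continuous paths is indistinguishable from a measurable process
all of whose paths are continuous. -/
lemma exists_continuous_modification {T : Type*} [TopologicalSpace T]
    [TopologicalSpace.SeparableSpace T] [FirstCountableTopology T] {W : T → Ω → ℝ}
    (hm : ∀ t, AEMeasurable (W t) P) (hc : ∀ᵐ ω ∂P, Continuous fun t => W t ω) :
    ∃ W' : T → Ω → ℝ, (∀ t, Measurable (W' t)) ∧ (∀ ω, Continuous fun t => W' t ω) ∧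
      ∀ᵐ ω ∂P, ∀ t, W' t ω = W t ω := by
  classical
  obtain ⟨s, hs, hsd⟩ := TopologicalSpace.exists_countable_dense T
  have hmk : ∀ᵐ ω ∂P, ∀ t ∈ s, W t ω = (hm t).mk _ ω := by
    have := hs.to_subtype
    have : ∀ᵐ ω ∂P, ∀ t : s, W t ω = (hm t).mk _ ω := ae_all_iff.2 fun t => (hm t).ae_eq_mk
    filter_upwards [this] with ω h t ht using h ⟨t, ht⟩
  obtain ⟨N, hN, hNm, hN0⟩ := exists_measurable_superset_of_null (hc.and hmk)
  have hgood : ∀ ω ∉ N, (Continuous fun t => W t ω) ∧ ∀ t ∈ s, W t ω = (hm t).mk _ ω :=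
    fun ω hω => by_contra fun h => hω (hN h)
  -- Off the null set `N`, paths are continuous and agree with measurable versions on a countable
  -- dense set; measurability at other times follows by taking limits along that set.
  refine ⟨fun t => Nᶜ.indicator (W t), fun t => ?_, fun ω => ?_, ?_⟩
  · obtain ⟨x, hx, hxt⟩ := mem_closure_iff_seq_limit.1 (hsd t)
    refine measurable_of_tendsto_metrizable (f := fun n => Nᶜ.indicator (W (x n))) (fun n => ?_) ?_
    · have : Nᶜ.indicator (W (x n)) = Nᶜ.indicator ((hm (x n)).mk _) :=
        Set.indicator_congr fun ω hω => (hgood ω hω).2 _ (hx n)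
      rw [this]
      exact (hm _).measurable_mk.indicator hNm.compl
    · rw [tendsto_pi_nhds]
      intro ω
      by_cases hω : ω ∈ N
      · simp [hω]
      · simpa [hω, Function.comp_def] using ((hgood ω hω).1.tendsto t).comp hxt
  · by_cases hω : ω ∈ N
    · simpa [hω] using continuous_const
    · simpa [hω] using (hgood ω hω).1
  · have : ∀ᵐ ω ∂P, ω ∉ N := measure_eq_zero_iff_ae_notMem.1 hN0
    filter_upwards [this] with ω hω t
    simp [hω]

/-- Cauchy–Schwarz, obtained by integrating the squared deviation of `f` from its mean over [0, t].
-/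
lemma sq_intervalIntegral_le {f : ℝ → ℝ} (hf : Continuous f) {t : ℝ} (ht : 0 ≤ t) :
    (∫ s in (0 : ℝ)..t, f s) ^ 2 ≤ t * ∫ s in (0 : ℝ)..t, f s ^ 2 := by
  rcases ht.eq_or_lt with rfl | ht
  · simp
  set I := ∫ s in (0 : ℝ)..t, f s
  have h : 0 ≤ ∫ s in (0 : ℝ)..t, (f s - I / t) ^ 2 :=
    intervalIntegral.integral_nonneg ht.le fun s _ => sq_nonneg _
  have e : ∫ s in (0 : ℝ)..t, (f s - I / t) ^ 2 =
      (∫ s in (0 : ℝ)..t, f s ^ 2) - 2 * (I / t) * I + (I / t) ^ 2 * t := by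
    have : ∀ s, (f s - I / t) ^ 2 = f s ^ 2 - 2 * (I / t) * f s + (I / t) ^ 2 := fun s => by ring
    simp_rw [this]
    rw [intervalIntegral.integral_add, intervalIntegral.integral_sub,
      intervalIntegral.integral_const_mul]
    · simp [mul_comm, I]
    all_goals exact Continuous.intervalIntegrable (by fun_prop) _ _
  rw [e] at h
  have h' : 0 ≤ t * ((∫ s in (0 : ℝ)..t, f s ^ 2) - 2 * (I / t) * I + (I / t) ^ 2 * t) :=
    mul_nonneg ht.le h
  have e' : t * ((∫ s in (0 : ℝ)..t, f s ^ 2) - 2 * (I / t) * I + (I / t) ^ 2 * t) =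
      t * (∫ s in (0 : ℝ)..t, f s ^ 2) - I ^ 2 := by
    field_simp
    ring
  linarith

variable [IsFiniteMeasure P] {w : ℝ → Ω → ℝ} {k : ℝ → ℝ} {t K : ℝ}

/-- Path continuity gives joint measurability, and the moment bound gives square integrability on
the product; this is what licenses Fubini below. -/
lemma memLp_uncurry (hwm : ∀ s, Measurable (w s)) (hwc : ∀ ω, Continuous fun s => w s ω)
    (hw2 : ∀ s, MemLp (w s) 2 P) (hK : ∀ s ∈ Set.Ioc 0 t, ∫ ω, w s ω ^ 2 ∂P ≤ K)
    (hk : Continuous k) :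
    MemLp (fun p : Ω × ℝ => k p.2 * w p.2 p.1) 2
      (P.prod (volume.restrict (Set.Ioc 0 t))) := by
  have hmeas : Measurable fun p : Ω × ℝ => k p.2 * w p.2 p.1 := by
    have h := measurable_uncurry_of_continuous_of_measurable (u := fun s ω => w s ω)
      (fun ω => hwc ω) hwm
    exact (hk.measurable.comp measurable_snd).mul (h.comp measurable_swap)
  obtain ⟨C, hC⟩ := (isCompact_Icc (a := (0 : ℝ)) (b := t)).exists_bound_of_continuousOn
    hk.continuousOn
  rw [memLp_two_iff_integrable_sq hmeas.aestronglyMeasurable,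
    integrable_prod_iff' (hmeas.pow_const 2).aestronglyMeasurable]
  have hint (s : ℝ) : Integrable (fun ω => (k s * w s ω) ^ 2) P := by
    simp_rw [mul_pow]
    exact (hw2 s).integrable_sq.const_mul _
  refine ⟨Eventually.of_forall hint, ?_⟩
  have hsm : AEStronglyMeasurable (fun s => ∫ ω, ‖(k s * w s ω) ^ 2‖ ∂P)
      (volume.restrict (Set.Ioc 0 t)) := by
    have h : AEStronglyMeasurable (fun p : ℝ × Ω => ‖(k p.1 * w p.1 p.2) ^ 2‖)
        ((volume.restrict (Set.Ioc 0 t)).prod P) :=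
      (((hmeas.comp measurable_swap).pow_const 2).norm).aestronglyMeasurable
    exact h.integral_prod_right'
  refine Integrable.mono' (g := fun _ => C ^ 2 * K) (integrable_const _) hsm ?_
  filter_upwards [ae_restrict_mem measurableSet_Ioc] with s hs
  have e : ∫ ω, ‖(k s * w s ω) ^ 2‖ ∂P = k s ^ 2 * ∫ ω, w s ω ^ 2 ∂P := by
    simp_rw [norm_pow, Real.norm_eq_abs, sq_abs, mul_pow]
    rw [integral_const_mul]
  have h0 : 0 ≤ ∫ ω, w s ω ^ 2 ∂P := integral_nonneg fun ω => sq_nonneg _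
  rw [e, Real.norm_of_nonneg (by positivity)]
  have hCs := hC s ⟨hs.1.le, hs.2⟩
  rw [Real.norm_eq_abs] at hCs
  have := pow_le_pow_left₀ (abs_nonneg _) hCs 2
  rw [sq_abs] at this
  exact mul_le_mul this (hK s hs) h0 (by positivity)

lemma memLp_intervalIntegral (ht : 0 ≤ t) (hwm : ∀ s, Measurable (w s))
    (hwc : ∀ ω, Continuous fun s => w s ω)
    (hw2 : ∀ s, MemLp (w s) 2 P) (hK : ∀ s ∈ Set.Ioc 0 t, ∫ ω, w s ω ^ 2 ∂P ≤ K)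
    (hk : Continuous k) :
    MemLp (fun ω => ∫ s in (0 : ℝ)..t, k s * w s ω) 2 P := by
  have h := memLp_uncurry hwm hwc hw2 hK hk
  simp_rw [intervalIntegral.integral_of_le ht]
  have hsm := h.aestronglyMeasurable.integral_prod_right'
  rw [memLp_two_iff_integrable_sq hsm]
  refine Integrable.mono' (h.integrable_sq.integral_prod_left.const_mul t) (hsm.pow 2) ?_
  refine Eventually.of_forall fun ω => ?_
  have := sq_intervalIntegral_le (f := fun s => k s * w s ω) (hk.mul (hwc ω)) ht
  rw [intervalIntegral.integral_of_le ht, intervalIntegral.integral_of_le ht] at this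
  rw [Real.norm_of_nonneg (sq_nonneg _)]
  exact this

lemma integral_mul_intervalIntegral (ht : 0 ≤ t) (hwm : ∀ s, Measurable (w s))
    (hwc : ∀ ω, Continuous fun s => w s ω)
    (hw2 : ∀ s, MemLp (w s) 2 P) (hK : ∀ s ∈ Set.Ioc 0 t, ∫ ω, w s ω ^ 2 ∂P ≤ K)
    (hk : Continuous k) {Y : Ω → ℝ} (hY : MemLp Y 2 P) :
    ∫ ω, Y ω * (∫ s in (0 : ℝ)..t, k s * w s ω) ∂P =
      ∫ s in (0 : ℝ)..t, k s * ∫ ω, Y ω * w s ω ∂P := by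
  have h := memLp_uncurry hwm hwc hw2 hK hk
  have hY' : MemLp (fun p : Ω × ℝ => Y p.1) 2 (P.prod (volume.restrict (Set.Ioc 0 t))) :=
    hY.comp_fst _
  have hi : Integrable (Function.uncurry fun (ω : Ω) (s : ℝ) => Y ω * (k s * w s ω))
      (P.prod (volume.restrict (Set.Ioc 0 t))) := hY'.integrable_mul h
  simp_rw [intervalIntegral.integral_of_le ht, ← integral_const_mul]
  rw [integral_integral_swap hi]
  simp_rw [mul_left_comm]

end ContinuousProcesses

/-! ### Wiener integrals of smooth functions -/

section Wiener

variable {Ω : Type*} [MeasurableSpace Ω] {P : Measure Ω}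

/-- A process with continuous paths and with the first two moments of a Brownian motion. -/
structure HasBrownianMoments (w : ℝ → Ω → ℝ) (P : Measure Ω) : Prop where
  measurable : ∀ s, Measurable (w s)
  continuous : ∀ ω, Continuous fun s => w s ω
  memLp : ∀ s, MemLp (w s) 2 P
  integral_eq_zero : ∀ s, ∫ ω, w s ω ∂P = 0
  integral_sq : ∀ s, 0 ≤ s → ∫ ω, w s ω ^ 2 ∂P = s

/-- The Wiener integral of `G` over `[0, t]` with respect to `w`, defined by integration by parts;
`G'` is the derivative of `G`. -/
noncomputable def wienerIntegral (w : ℝ → Ω → ℝ) (G G' : ℝ → ℝ) (t : ℝ) (ω : Ω) : ℝ :=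
  G t * w t ω - ∫ s in (0 : ℝ)..t, G' s * w s ω

variable [IsFiniteMeasure P] {w w' : ℝ → Ω → ℝ} {G G' H H' : ℝ → ℝ} {t c : ℝ}

namespace HasBrownianMoments

omit [IsFiniteMeasure P] in
lemma integral_sq_le (hw : HasBrownianMoments w P) : ∀ s ∈ Set.Ioc 0 t, ∫ ω, w s ω ^ 2 ∂P ≤ t :=
  fun s hs => (hw.integral_sq s hs.1.le).trans_le hs.2

lemma memLp_wienerIntegral (hw : HasBrownianMoments w P) (ht : 0 ≤ t) (hG' : Continuous G') :
    MemLp (wienerIntegral w G G' t) 2 P :=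
  ((hw.memLp t).const_mul (G t)).sub
    (memLp_intervalIntegral ht hw.measurable hw.continuous hw.memLp hw.integral_sq_le hG')

lemma integral_mul_wienerIntegral (hw : HasBrownianMoments w P) (ht : 0 ≤ t)
    (hG' : Continuous G') {Y : Ω → ℝ} (hY : MemLp Y 2 P) :
    ∫ ω, Y ω * wienerIntegral w G G' t ω ∂P =
      G t * ∫ ω, Y ω * w t ω ∂P - ∫ s in (0 : ℝ)..t, G' s * ∫ ω, Y ω * w s ω ∂P := by
  rw [← integral_mul_intervalIntegral ht hw.measurable hw.continuous hw.memLp hw.integral_sq_le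
    hG' hY, ← integral_const_mul, ← integral_sub]
  · congr with ω
    simp only [wienerIntegral]
    ring
  · exact (hY.integrable_mul (hw.memLp t)).const_mul _
  · exact hY.integrable_mul
      (memLp_intervalIntegral ht hw.measurable hw.continuous hw.memLp hw.integral_sq_le hG')

lemma integral_wienerIntegral [IsProbabilityMeasure P] (hw : HasBrownianMoments w P) (ht : 0 ≤ t)
    (hG' : Continuous G') : ∫ ω, wienerIntegral w G G' t ω ∂P = 0 := by
  have := hw.integral_mul_wienerIntegral (G := G) ht hG' (memLp_const (1 : ℝ))
  simpa [hw.integral_eq_zero] using this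

/-- Split the correction integral at `r`, where min(s, r) changes branch, and integrate by parts on
[0, r]; the boundary terms cancel. The constant `c` covers equal processes (1) and uncorrelated ones
(0). -/
lemma integral_eval_mul_wienerIntegral (hw : HasBrownianMoments w P)
    (hw' : HasBrownianMoments w' P)
    (hc : ∀ s r, 0 ≤ s → 0 ≤ r → ∫ ω, w' s ω * w r ω ∂P = c * min s r)
    (hG : ∀ s, HasDerivAt G (G' s) s) (hG' : Continuous G') {r : ℝ} (hr : r ∈ Set.Icc 0 t) :
    ∫ ω, w' r ω * wienerIntegral w G G' t ω ∂P = c * ∫ s in (0 : ℝ)..r, G s := by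
  have hGc : Continuous G := continuous_iff_continuousAt.2 fun s => (hG s).continuousAt
  have h0t : 0 ≤ t := hr.1.trans hr.2
  have hint {a b : ℝ} (ha : 0 ≤ a) (hb : 0 ≤ b) :
      IntervalIntegrable (fun s => G' s * ∫ ω, w' r ω * w s ω ∂P) volume a b := by
    have h : Continuous fun s => G' s * (c * min r s) := by fun_prop
    refine (h.continuousOn.congr fun s hs => ?_).intervalIntegrable
    have hs : 0 ≤ s := (le_min ha hb).trans hs.1
    simp only [hc r s hr.1 hs]
  rw [hw.integral_mul_wienerIntegral h0t hG' (hw'.memLp r),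
    ← intervalIntegral.integral_add_adjacent_intervals (b := r)
      (hint le_rfl hr.1) (hint hr.1 h0t)]
  have e1 : ∫ s in (0 : ℝ)..r, G' s * ∫ ω, w' r ω * w s ω ∂P =
      c * ∫ s in (0 : ℝ)..r, s * G' s := by
    rw [← intervalIntegral.integral_const_mul]
    refine intervalIntegral.integral_congr fun s hs => ?_
    rw [Set.uIcc_of_le hr.1] at hs
    simp only [hc r s hr.1 hs.1, min_eq_right hs.2]
    ring
  have e2 : ∫ s in r..t, G' s * ∫ ω, w' r ω * w s ω ∂P = c * r * (G t - G r) := by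
    rw [← intervalIntegral.integral_eq_sub_of_hasDerivAt (fun s _ => hG s)
      (hG'.intervalIntegrable _ _), ← intervalIntegral.integral_const_mul]
    refine intervalIntegral.integral_congr fun s hs => ?_
    rw [Set.uIcc_of_le hr.2] at hs
    simp only [hc r s hr.1 (hr.1.trans hs.1), min_eq_left hs.1]
    ring
  have e3 : ∫ s in (0 : ℝ)..r, s * G' s = r * G r - 0 * G 0 - ∫ s in (0 : ℝ)..r, 1 * G s :=
    intervalIntegral.integral_mul_deriv_eq_deriv_mul (fun s _ => hasDerivAt_id s)
      (fun s _ => hG s) (continuous_const.intervalIntegrable _ _) (hG'.intervalIntegrable _ _)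
  rw [e1, e2, e3, hc r t hr.1 h0t, min_eq_left hr.2]
  simp only [one_mul]
  ring

/-- The Itô isometry. -/
lemma integral_wienerIntegral_mul_wienerIntegral (hw : HasBrownianMoments w P)
    (hw' : HasBrownianMoments w' P)
    (hc : ∀ s r, 0 ≤ s → 0 ≤ r → ∫ ω, w' s ω * w r ω ∂P = c * min s r)
    (hG : ∀ s, HasDerivAt G (G' s) s) (hG' : Continuous G')
    (hH : ∀ s, HasDerivAt H (H' s) s) (hH' : Continuous H') (ht : 0 ≤ t) :
    ∫ ω, wienerIntegral w G G' t ω * wienerIntegral w' H H' t ω ∂P =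
      c * ∫ s in (0 : ℝ)..t, G s * H s := by
  have hGc : Continuous G := continuous_iff_continuousAt.2 fun s => (hG s).continuousAt
  have hHc : Continuous H := continuous_iff_continuousAt.2 fun s => (hH s).continuousAt
  rw [hw'.integral_mul_wienerIntegral ht hH' (hw.memLp_wienerIntegral ht hG')]
  have e (r : ℝ) (hr : r ∈ Set.Icc 0 t) : ∫ ω, wienerIntegral w G G' t ω * w' r ω ∂P =
      c * ∫ s in (0 : ℝ)..r, G s := by
    simp_rw [mul_comm (wienerIntegral w G G' t _)]
    exact hw.integral_eval_mul_wienerIntegral hw' hc hG hG' hr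
  have e1 : ∫ r in (0 : ℝ)..t, H' r * ∫ ω, wienerIntegral w G G' t ω * w' r ω ∂P =
      c * ∫ r in (0 : ℝ)..t, (∫ s in (0 : ℝ)..r, G s) * H' r := by
    rw [← intervalIntegral.integral_const_mul]
    refine intervalIntegral.integral_congr fun r hr => ?_
    rw [Set.uIcc_of_le ht] at hr
    simp only [e r hr]
    ring
  have e2 : ∫ r in (0 : ℝ)..t, (∫ s in (0 : ℝ)..r, G s) * H' r =
      (∫ s in (0 : ℝ)..t, G s) * H t - (∫ s in (0 : ℝ)..0, G s) * H 0 -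
        ∫ r in (0 : ℝ)..t, G r * H r :=
    intervalIntegral.integral_mul_deriv_eq_deriv_mul
      (fun r _ => hGc.integral_hasStrictDerivAt 0 r |>.hasDerivAt)
      (fun s _ => hH s) (hGc.intervalIntegrable _ _) (hH'.intervalIntegrable _ _)
  rw [e1, e2, e t ⟨ht, le_rfl⟩, intervalIntegral.integral_same]
  ring

end HasBrownianMoments

/-- The variance of a sum of Wiener integrals with respect to uncorrelated processes. -/
lemma variance_sum_wienerIntegral [IsProbabilityMeasure P] {κ : Type*} [Fintype κ]
    {w : κ → ℝ → Ω → ℝ} (hw : ∀ j, HasBrownianMoments (w j) P)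
    (hww : ∀ j k, j ≠ k → ∀ s r, ∫ ω, w j s ω * w k r ω ∂P = 0)
    (hself : ∀ j s r, 0 ≤ s → 0 ≤ r → ∫ ω, w j s ω * w j r ω ∂P = min s r)
    {G G' : κ → ℝ → ℝ} (hG : ∀ j s, HasDerivAt (G j) (G' j s) s) (hG' : ∀ j, Continuous (G' j))
    {t : ℝ} (ht : 0 ≤ t) :
    Var[fun ω => ∑ j, wienerIntegral (w j) (G j) (G' j) t ω; P] =
      ∫ s in (0 : ℝ)..t, ∑ j, G j s ^ 2 := by
  classical
  have hm (j : κ) := (hw j).memLp_wienerIntegral (G := G j) ht (hG' j)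
  have hGc (j : κ) : Continuous (G j) :=
    continuous_iff_continuousAt.2 fun s => (hG j s).continuousAt
  rw [variance_fun_sum hm, intervalIntegral.integral_finsetSum (f := fun j s => G j s ^ 2)
    fun j _ => ((hGc j).pow 2).intervalIntegrable _ _]
  refine Finset.sum_congr rfl fun j _ => ?_
  have hcov (k : κ) : cov[wienerIntegral (w j) (G j) (G' j) t, wienerIntegral (w k) (G k) (G' k) t;
      P] = (if j = k then 1 else 0) * ∫ s in (0 : ℝ)..t, G j s * G k s := by
    rw [covariance_eq_sub (hm j) (hm k), (hw j).integral_wienerIntegral ht (hG' j), zero_mul,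
      sub_zero]
    refine (hw j).integral_wienerIntegral_mul_wienerIntegral (hw k) (fun s r hs hr => ?_) (hG j)
      (hG' j) (hG k) (hG' k) ht
    split_ifs with h
    · rw [← h, hself j s r hs hr, one_mul]
    · rw [hww k j (Ne.symm h), zero_mul]
  rw [Finset.sum_eq_single j]
  · rw [hcov j, if_pos rfl, one_mul]
    simp_rw [sq]
  · intro k _ hk
    rw [hcov k, if_neg hk.symm, zero_mul]
  · simp

end Wiener

/-! ### Linear functionals of noisy linear systems -/

section Duhamel

variable {ι κ : Type*} [Fintype ι] [Fintype κ]

/-- Variation of constants, tested against a solution `u` of the adjoint equation. -/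
lemma dotProduct_eq_of_integral_equation {A : Matrix ι ι ℝ} {B : Matrix ι κ ℝ} {x : ℝ≥0 → ι → ℝ}
    {w : ℝ → κ → ℝ} (hx : Continuous x)
    (heq : ∀ t i, x t i = x 0 i + (∫ s in (0 : ℝ)..t, (A *ᵥ x s.toNNReal) i) + (B *ᵥ w t) i)
    {u : ℝ → ι → ℝ} (hu : ∀ τ, HasDerivAt u (u τ ᵥ* A) τ) {t : ℝ≥0}
    (hw : Continuous w) :
    u 0 ⬝ᵥ x t = u t ⬝ᵥ x 0 + ∑ j, ((u 0 ᵥ* B) j * w t j -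
      ∫ s in (0 : ℝ)..t, -(u (t - s) ᵥ* A ᵥ* B) j * w s j) := by
  have huc : Continuous u := continuous_iff_continuousAt.2 fun s => (hu s).continuousAt
  have hxc : Continuous fun s : ℝ => x s.toNNReal := hx.comp continuous_real_toNNReal
  -- The solution minus its noise term is differentiable even though the solution is not. Along it
  -- the adjoint pairing u(t - s)·z(s) has derivative u(t - s) A B w(s), in which only the noise
  -- survives.
  set z : ℝ → ι → ℝ := fun s i => x 0 i + ∫ r in (0 : ℝ)..s, (A *ᵥ x r.toNNReal) i with hz
  have hAx (i : ι) : Continuous fun r : ℝ => (A *ᵥ x r.toNNReal) i := by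
    simp only [Matrix.mulVec, dotProduct]
    fun_prop
  have hz' (s : ℝ) (i : ι) : HasDerivAt (fun s => z s i) ((A *ᵥ x s.toNNReal) i) s :=
    ((hAx i).integral_hasStrictDerivAt 0 s).hasDerivAt.const_add _
  have hxz (s : ℝ) (hs : 0 ≤ s) : x s.toNNReal = z s + B *ᵥ w s := by
    ext i
    rw [heq, Real.coe_toNNReal _ hs]
    rfl
  have hu' (s : ℝ) (i : ι) : HasDerivAt (fun s => u (t - s) i) (-(u (t - s) ᵥ* A) i) s := by
    have := (hasDerivAt_pi.1 (hu (t - s)) i).comp s ((hasDerivAt_id s).const_sub (t : ℝ))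
    simpa [Function.comp_def] using this
  have hφ (s : ℝ) : HasDerivAt (fun s => u (t - s) ⬝ᵥ z s)
      (∑ i, (-(u (t - s) ᵥ* A) i * z s i + u (t - s) i * (A *ᵥ x s.toNNReal) i)) s :=
    HasDerivAt.fun_sum fun i _ => (hu' s i).mul (hz' s i)
  have hφ' (s : ℝ) (hs : 0 ≤ s) :
      ∑ i, (-(u (t - s) ᵥ* A) i * z s i + u (t - s) i * (A *ᵥ x s.toNNReal) i) =
        ∑ j, (u (t - s) ᵥ* A ᵥ* B) j * w s j := by
    have e1 : ∑ i, (-(u (t - s) ᵥ* A) i * z s i + u (t - s) i * (A *ᵥ x s.toNNReal) i) =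
        -((u (t - s) ᵥ* A) ⬝ᵥ z s) + u (t - s) ⬝ᵥ (A *ᵥ x s.toNNReal) := by
      simp [dotProduct, Finset.sum_add_distrib]
    rw [e1, Matrix.dotProduct_mulVec, hxz s hs, dotProduct_add, Matrix.dotProduct_mulVec]
    simp only [dotProduct]
    ring
  have hcont : Continuous fun s => ∑ j, (u (t - s) ᵥ* A ᵥ* B) j * w s j := by
    simp only [Matrix.vecMul, dotProduct]
    fun_prop
  have hFTC : ∫ s in (0 : ℝ)..t, ∑ j, (u (t - s) ᵥ* A ᵥ* B) j * w s j =
      u 0 ⬝ᵥ z t - u t ⬝ᵥ x 0 := by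
    have h := intervalIntegral.integral_eq_sub_of_hasDerivAt (a := 0) (b := (t : ℝ))
      (f := fun s => u (t - s) ⬝ᵥ z s)
      (f' := fun s => ∑ j, (u (t - s) ᵥ* A ᵥ* B) j * w s j) (fun s hs => by
        rw [Set.uIcc_of_le (NNReal.coe_nonneg t)] at hs
        rw [← hφ' s hs.1]
        exact hφ s) (hcont.intervalIntegrable _ _)
    have hz0 : z 0 = x 0 := by ext i; simp [hz]
    simpa [hz0] using h
  rw [intervalIntegral.integral_finsetSum
    (f := fun j s => (u (t - s) ᵥ* A ᵥ* B) j * w s j)] at hFTC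
  · have := hxz t t.2
    rw [Real.toNNReal_coe] at this
    rw [this, dotProduct_add, Matrix.dotProduct_mulVec, Finset.sum_sub_distrib]
    simp only [neg_mul, intervalIntegral.integral_neg, Finset.sum_neg_distrib, hFTC]
    simp only [dotProduct]
    ring
  · intro j _
    refine Continuous.intervalIntegrable ?_ _ _
    simp only [Matrix.vecMul, dotProduct]
    fun_prop

end Duhamel

/-! ### Limits of variances under small perturbations in L² -/

section Covariance

variable {Ω : Type*} [MeasurableSpace Ω] {P : Measure Ω} [IsProbabilityMeasure P]

/-- The Cauchy-Schwarz inequality for covariances. -/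
lemma covariance_sq_le {X Y : Ω → ℝ} (hX : MemLp X 2 P) (hY : MemLp Y 2 P) :
    cov[X, Y; P] ^ 2 ≤ Var[X; P] * Var[Y; P] := by
  have h (r : ℝ) : 0 ≤ Var[X; P] * (r * r) + (2 * cov[X, Y; P]) * r + Var[Y; P] := by
    have := variance_nonneg (fun ω => r * X ω + Y ω) P
    rw [variance_fun_add (hX.const_mul r) hY, variance_const_mul, covariance_const_mul_left] at this
    linarith
  have := discrim_le_zero h
  rw [discrim] at this
  linarith

/-- A family of random variables that converges to zero in `L²` does not change limits of
variances. -/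
lemma tendsto_variance_add {α : Type*} {l : Filter α} {R M : α → Ω → ℝ} {σ : ℝ}
    (hR : ∀ a, MemLp (R a) 2 P) (hM : ∀ a, MemLp (M a) 2 P)
    (hR0 : Tendsto (fun a => Var[R a; P]) l (𝓝 0)) (hMσ : Tendsto (fun a => Var[M a; P]) l (𝓝 σ)) :
    Tendsto (fun a => Var[fun ω => R a ω + M a ω; P]) l (𝓝 σ) := by
  have hcov : Tendsto (fun a => cov[R a, M a; P]) l (𝓝 0) := by
    have h0 : Tendsto (fun a => √(Var[R a; P] * Var[M a; P])) l (𝓝 0) := by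
      simpa using (hR0.mul hMσ).sqrt
    refine squeeze_zero_norm (fun a => ?_) h0
    exact Real.abs_le_sqrt (covariance_sq_le (hR a) (hM a))
  have := (hR0.add (hcov.const_mul 2)).add hMσ
  simp only [mul_zero, zero_add] at this
  refine this.congr fun a => ?_
  rw [variance_fun_add (hR a) (hM a)]

end Covariance

/-! ### Wiener representation and limiting variance of linear functionals -/

section Functionals

variable {ι κ Ω : Type*} [Fintype ι] [Fintype κ] [MeasurableSpace Ω] {P : Measure Ω}
  [IsProbabilityMeasure P] {A : Matrix ι ι ℝ} {B : Matrix ι κ ℝ} {W : κ → ℝ≥0 → Ω → ℝ}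
  {X : ℝ≥0 → Ω → ι → ℝ}

/-- Linear functionals of the solution are, up to an initial layer, Wiener integrals. -/
lemma IsNoisyLinearSystem.exists_wienerIntegral (h : IsNoisyLinearSystem A B P W X) :
    ∃ w : κ → ℝ → Ω → ℝ, (∀ j, HasBrownianMoments (w j) P) ∧
      (∀ j k, j ≠ k → ∀ s r, ∫ ω, w j s ω * w k r ω ∂P = 0) ∧
      (∀ j s r, 0 ≤ s → 0 ≤ r → ∫ ω, w j s ω * w j r ω ∂P = min s r) ∧
      ∀ u : ℝ → ι → ℝ, (∀ τ, HasDerivAt u (u τ ᵥ* A) τ) → ∀ t : ℝ≥0,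
        (fun ω => u 0 ⬝ᵥ X t ω) =ᵐ[P] fun ω => u t ⬝ᵥ X 0 ω +
          ∑ j, wienerIntegral (w j) (fun s => (u (t - s) ᵥ* B) j)
            (fun s => -(u (t - s) ᵥ* A ᵥ* B) j) t ω := by
  choose W' hWm hWc hWe using fun j => exists_continuous_modification
    (fun t => (h.brownian j).aemeasurable t) (h.brownian j).cont
  have hae (j : κ) (s : ℝ≥0) : W' j s =ᵐ[P] W j s := by
    filter_upwards [hWe j] with ω hω using hω s
  have hL2 (j : κ) (s : ℝ≥0) : MemLp (W j s) 2 P :=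
    ((h.brownian j).hasLaw_eval s).hasGaussianLaw.memLp_two
  have hmean (j : κ) (s : ℝ≥0) : ∫ ω, W j s ω ∂P = 0 := (h.brownian j).integral_eval s
  have hmul (j k : κ) (s r : ℝ≥0) : ∫ ω, W' j s ω * W' k r ω ∂P = cov[W j s, W k r; P] := by
    rw [covariance_eq_sub (hL2 j s) (hL2 k r), hmean, zero_mul, sub_zero]
    exact integral_congr_ae ((hae j s).mul (hae k r))
  have hself (j : κ) (s r : ℝ) (hs : 0 ≤ s) (hr : 0 ≤ r) :
      ∫ ω, W' j s.toNNReal ω * W' j r.toNNReal ω ∂P = min s r := by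
    rw [hmul, (h.brownian j).covariance_eval]
    simp [hs, hr]
  refine ⟨fun j s => W' j s.toNNReal, fun j => ?_, fun j k hjk s r => ?_, hself, fun u hu t => ?_⟩
  · refine ⟨fun s => hWm j _, fun ω => (hWc j ω).comp continuous_real_toNNReal,
      fun s => (memLp_congr_ae (hae j _)).2 (hL2 j _), fun s => ?_, fun s hs => ?_⟩
    · rw [integral_congr_ae (hae j _), hmean]
    · simp_rw [sq]
      rw [hself j s s hs hs, min_self]
  · rw [hmul]
    refine IndepFun.covariance_eq_zero ?_ (hL2 _ _) (hL2 _ _)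
    exact (h.indep.indepFun hjk).comp (measurable_pi_apply s.toNNReal)
      (measurable_pi_apply r.toNNReal)
  · filter_upwards [h.equation, ae_all_iff.2 hWe] with ω hω hWω
    have := dotProduct_eq_of_integral_equation (B := B) (w := fun s j => W' j s.toNNReal ω) hω.1
      (fun t i => by
        rw [hω.2 t i]
        simp [hWω]) hu (t := t)
      (continuous_pi fun j => (hWc j ω).comp continuous_real_toNNReal)
    rw [this]
    simp [wienerIntegral]

variable {u : ℝ → ι → ℝ}

/-- The variance of a linear functional of the solution converges, provided that the adjoint
solution `u` decays. -/
lemma IsNoisyLinearSystem.tendsto_variance (h : IsNoisyLinearSystem A B P W X)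
    (hu : ∀ τ, HasDerivAt u (u τ ᵥ* A) τ) :
    (∀ t, MemLp (fun ω => u 0 ⬝ᵥ X t ω) 2 P) ∧
    ∀ σ, Tendsto u atTop (𝓝 0) →
      Tendsto (fun t => ∫ s in (0 : ℝ)..t, ∑ j, (u s ᵥ* B) j ^ 2) atTop (𝓝 σ) →
      Tendsto (fun t => Var[fun ω => u 0 ⬝ᵥ X t ω; P]) atTop (𝓝 σ) := by
  obtain ⟨w, hw, hww, hself, hX⟩ := h.exists_wienerIntegral
  have huc : Continuous u := continuous_iff_continuousAt.2 fun s => (hu s).continuousAt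
  set M : ℝ≥0 → Ω → ℝ := fun t ω => ∑ j, wienerIntegral (w j) (fun s => (u (t - s) ᵥ* B) j)
    (fun s => -(u (t - s) ᵥ* A ᵥ* B) j) t ω with hM
  have hG' (t : ℝ≥0) (j : κ) : Continuous fun s : ℝ => -(u (t - s) ᵥ* A ᵥ* B) j := by
    simp only [Matrix.vecMul, dotProduct]
    fun_prop
  have hG (t : ℝ≥0) (j : κ) (s : ℝ) : HasDerivAt (fun s : ℝ => (u (t - s) ᵥ* B) j)
      (-(u (t - s) ᵥ* A ᵥ* B) j) s := by
    have hu' (i : ι) : HasDerivAt (fun s => u (t - s) i) (-(u (t - s) ᵥ* A) i) s := by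
      have := (hasDerivAt_pi.1 (hu (t - s)) i).comp s ((hasDerivAt_id s).const_sub (t : ℝ))
      simpa [Function.comp_def] using this
    have := HasDerivAt.fun_sum fun i (_ : i ∈ Finset.univ) => (hu' i).mul_const (B i j)
    simpa [Matrix.vecMul, dotProduct] using this
  have hR2 (t : ℝ≥0) : MemLp (fun ω => u t ⬝ᵥ X 0 ω) 2 P :=
    memLp_finsetSum _ fun i _ => (h.initial i).const_mul _
  have hM2 (t : ℝ≥0) : MemLp (M t) 2 P :=
    memLp_finsetSum _ fun j _ => (hw j).memLp_wienerIntegral t.2 (hG' t j)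
  refine ⟨fun t => (memLp_congr_ae (hX u hu t)).2 ((hR2 t).add (hM2 t)), fun σ hu0 hσ => ?_⟩
  have hMv (t : ℝ≥0) : Var[M t; P] = ∫ s in (0 : ℝ)..t, ∑ j, (u s ᵥ* B) j ^ 2 := by
    refine (variance_sum_wienerIntegral hw hww hself (hG t) (hG' t) t.2).trans ?_
    simpa using intervalIntegral.integral_comp_sub_left (a := 0) (b := (t : ℝ))
      (fun s => ∑ j, (u s ᵥ* B) j ^ 2) (t : ℝ)
  have hRv : Tendsto (fun t : ℝ≥0 => Var[fun ω => u t ⬝ᵥ X 0 ω; P]) atTop (𝓝 0) := by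
    have e (t : ℝ≥0) : Var[fun ω => u t ⬝ᵥ X 0 ω; P] =
        ∑ i, ∑ j, u t i * (u t j * cov[fun ω => X 0 ω i, fun ω => X 0 ω j; P]) := by
      simp only [dotProduct]
      rw [variance_fun_sum fun i => (h.initial i).const_mul _]
      simp_rw [covariance_const_mul_left, covariance_const_mul_right]
    simp_rw [e]
    have hu0' (i : ι) : Tendsto (fun t : ℝ≥0 => u t i) atTop (𝓝 0) :=
      (tendsto_pi_nhds.1 hu0 i).comp (NNReal.tendsto_coe_atTop.2 tendsto_id)
    have := tendsto_finsetSum Finset.univ fun i _ => tendsto_finsetSum Finset.univ fun j _ =>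
      (hu0' i).mul ((hu0' j).mul_const (cov[fun ω => X 0 ω i, fun ω => X 0 ω j; P]))
    simpa using this
  -- The initial state may be correlated with the noise; its covariance with `M` vanishes in the
  -- limit by Cauchy–Schwarz.
  have := tendsto_variance_add hR2 hM2 hRv (σ := σ) (by
    simp_rw [hMv]
    exact hσ.comp (NNReal.tendsto_coe_atTop.2 tendsto_id))
  refine this.congr fun t => (variance_congr (hX u hu t)).symm

end Functionals

/-! ### The adjoint equations of the modes -/

section Modes

/-- The adjoint equation of a damped mode. -/
lemma exists_dampedMode {c : ℝ} (hc : 0 < c) : ∃ p q : ℝ → ℝ, p 0 = 1 ∧ q 0 = 0 ∧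
    (∀ t, HasDerivAt p (-c * q t) t) ∧ (∀ t, HasDerivAt q (p t - c * q t) t) ∧
    Tendsto p atTop (𝓝 0) ∧ Tendsto q atTop (𝓝 0) ∧
    Tendsto (fun t => ∫ s in (0 : ℝ)..t, q s ^ 2) atTop (𝓝 (1 / (2 * c ^ 2))) := by
  let T : ℝ × ℝ →L[ℝ] ℝ × ℝ :=
    ((-c) • ContinuousLinearMap.snd ℝ ℝ ℝ).prod
      (ContinuousLinearMap.fst ℝ ℝ ℝ - c • ContinuousLinearMap.snd ℝ ℝ ℝ)
  let y : ℝ → ℝ × ℝ := fun t => NormedSpace.exp (t • T) (1, 0)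
  have hy (t : ℝ) : HasDerivAt y (T (y t)) t := by
    have := (hasDerivAt_exp_smul_const' T t).clm_apply (hasDerivAt_const t ((1 : ℝ), (0 : ℝ)))
    simpa using this
  have hy0 : y 0 = (1, 0) := by simp [y]
  obtain ⟨p, q, hp0, hq0, hp, hq⟩ : ∃ p q : ℝ → ℝ, p 0 = 1 ∧ q 0 = 0 ∧
      (∀ t, HasDerivAt p (-c * q t) t) ∧ (∀ t, HasDerivAt q (p t - c * q t) t) :=
    ⟨fun t => (y t).1, fun t => (y t).2, by simp [hy0], by simp [hy0],
      fun t => by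
        simpa [T, Function.comp_def] using
          (ContinuousLinearMap.fst ℝ ℝ ℝ).hasFDerivAt.comp_hasDerivAt t (hy t),
      fun t => by
        simpa [T, Function.comp_def] using
          (ContinuousLinearMap.snd ℝ ℝ ℝ).hasFDerivAt.comp_hasDerivAt t (hy t)⟩
  have hqc : Continuous q := continuous_iff_continuousAt.2 fun t => (hq t).continuousAt
  -- A Lyapunov function weighted so that the mixed terms of its derivative cancel, leaving -q².
  -- Hence the integral of q² equals E(0) - E(t), and E(0) = 1/(2c²).
  set E : ℝ → ℝ := fun t => p t ^ 2 / (2 * c ^ 2) + q t ^ 2 / (2 * c) with hE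
  have hE' (t : ℝ) : HasDerivAt E (-(q t ^ 2)) t := by
    convert! (((hp t).pow 2).div_const (2 * c ^ 2)).add (((hq t).pow 2).div_const (2 * c)) using 1
    field_simp
    push_cast
    ring
  -- As E does not control p through its derivative, a second function F with F' = -(p² + q²) is
  -- used; this equation determines α and γ. Since E ≤ D(p² + q²), the function tE + DF is antitone
  -- for t ≥ 0, so E = O(1/t).
  set D : ℝ := 1 / (2 * c ^ 2) + 1 / (2 * c) with hD
  set γ : ℝ := 1 / (2 * c) + 1 / 2 with hγ
  set α : ℝ := γ / c + 1 / 2 with hα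
  set F : ℝ → ℝ := fun t => α * p t ^ 2 - p t * q t + γ * q t ^ 2 with hF
  have hF' (t : ℝ) : HasDerivAt F (-(p t ^ 2 + q t ^ 2)) t := by
    convert! ((((hp t).pow 2).const_mul α).sub ((hp t).mul (hq t))).add
      (((hq t).pow 2).const_mul γ) using 1
    rw [hα, hγ]
    field_simp
    push_cast
    ring
  have hF0 (t : ℝ) : 0 ≤ F t := by
    have : F t = (p t - q t) ^ 2 / 2 + γ / c * p t ^ 2 + 1 / (2 * c) * q t ^ 2 := by
      simp only [hF, hα, hγ]
      ring
    rw [this]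
    positivity
  have hanti : AntitoneOn (fun t => t * E t + D * F t) (Set.Ici 0) := by
    have hd (t : ℝ) : HasDerivAt (fun t => t * E t + D * F t)
        (1 * E t + t * -(q t ^ 2) + D * -(p t ^ 2 + q t ^ 2)) t :=
      ((hasDerivAt_id t).mul (hE' t)).add ((hF' t).const_mul D)
    refine antitoneOn_of_deriv_nonpos (convex_Ici 0)
      (fun t _ => (hd t).continuousAt.continuousWithinAt)
      (fun t _ => (hd t).differentiableAt.differentiableWithinAt) fun t ht => ?_
    rw [interior_Ici, Set.mem_Ioi] at ht
    rw [(hd t).deriv]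
    have : 1 * E t + t * -(q t ^ 2) + D * -(p t ^ 2 + q t ^ 2) =
        -(t * q t ^ 2 + p t ^ 2 / (2 * c) + q t ^ 2 / (2 * c ^ 2)) := by
      simp only [hE, hD]
      ring
    rw [this, neg_nonpos]
    positivity
  have hEnn (t : ℝ) : 0 ≤ E t := by positivity
  have hE0 : Tendsto E atTop (𝓝 0) := by
    have h : Tendsto (fun t : ℝ => D * F 0 * t⁻¹) atTop (𝓝 0) := by
      simpa using tendsto_inv_atTop_zero.const_mul (D * F 0)
    refine squeeze_zero' (Eventually.of_forall hEnn) ?_ h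
    filter_upwards [eventually_gt_atTop 0] with t ht
    have h1 := hanti Set.self_mem_Ici ht.le ht.le
    have h2 : 0 ≤ D * F t := mul_nonneg (by positivity) (hF0 t)
    simp only [zero_mul, zero_add] at h1
    rw [← div_eq_mul_inv, le_div_iff₀ ht]
    linarith
  have hlim {f : ℝ → ℝ} {b : ℝ} (h : ∀ t, f t ^ 2 ≤ b * E t) : Tendsto f atTop (𝓝 0) := by
    refine squeeze_zero_norm (fun t => ?_) (by simpa using (hE0.const_mul b).sqrt)
    exact Real.abs_le_sqrt (h t)
  refine ⟨p, q, hp0, hq0, hp, hq, hlim (b := 2 * c ^ 2) fun t => ?_, hlim (b := 2 * c) fun t => ?_,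
    ?_⟩
  · have : 2 * c ^ 2 * E t = p t ^ 2 + c * q t ^ 2 := by
      simp only [hE]
      field_simp
    rw [this]
    exact le_add_of_nonneg_right (by positivity)
  · have : 2 * c * E t = p t ^ 2 / c + q t ^ 2 := by
      simp only [hE]
      field_simp
    rw [this]
    exact le_add_of_nonneg_left (by positivity)
  · have h1 (t : ℝ) : ∫ s in (0 : ℝ)..t, q s ^ 2 = 1 / (2 * c ^ 2) - E t := by
      have := intervalIntegral.integral_eq_sub_of_hasDerivAt (a := 0) (b := t)
        (fun s _ => (hE' s).neg)
          ((by fun_prop : Continuous fun s => - -(q s ^ 2)).intervalIntegrable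
          _ _)
      simp only [neg_neg, Pi.neg_apply] at this
      rw [this]
      simp [hE, hp0, hq0]
      ring
    simp_rw [h1]
    have h2 := hE0.const_sub (1 / (2 * c ^ 2))
    rw [sub_zero] at h2
    exact h2

lemma tendsto_integral_exp {c : ℝ} (hc : 0 < c) :
    Tendsto (fun t => ∫ s in (0 : ℝ)..t, Real.exp (-c * s) ^ 2) atTop (𝓝 (1 / (2 * c))) := by
  have hd (s : ℝ) : HasDerivAt (fun s => -(Real.exp (-c * s) ^ 2) / (2 * c))
      (Real.exp (-c * s) ^ 2) s := by
    convert! ((((hasDerivAt_id s).const_mul (-c)).exp.pow 2).neg).div_const (2 * c) using 1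
    simp
    field_simp
  have h1 (t : ℝ) : ∫ s in (0 : ℝ)..t, Real.exp (-c * s) ^ 2 =
      1 / (2 * c) - Real.exp (-c * t) ^ 2 / (2 * c) := by
    rw [intervalIntegral.integral_eq_sub_of_hasDerivAt (fun s _ => hd s)
      (Continuous.intervalIntegrable (by fun_prop) _ _)]
    simp
    ring
  simp_rw [h1]
  have : Tendsto (fun t => Real.exp (-c * t)) atTop (𝓝 0) :=
    Real.tendsto_exp_atBot.comp (tendsto_id.const_mul_atTop_of_neg (neg_lt_zero.2 hc))
  simpa using ((this.pow 2).div_const (2 * c)).const_sub (1 / (2 * c))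

end Modes

/-! ### Decomposition of the dynamics into Laplacian modes -/

section SpectralDecomposition

variable {V : Type*} [Fintype V] [DecidableEq V] (G : SimpleGraph V) [DecidableRel G.Adj]

/-- An orthonormal basis of eigenvectors of the Laplacian matrix. -/
noncomputable def lapEigenvector (i : V) : V → ℝ :=
  (G.posSemidef_lapMatrix ℝ).isHermitian.eigenvectorBasis i

lemma lapMatrix_mulVec_lapEigenvector (i : V) :
    G.lapMatrix ℝ *ᵥ lapEigenvector G i = lapEigenvalues G i • lapEigenvector G i :=
  (G.posSemidef_lapMatrix ℝ).isHermitian.mulVec_eigenvectorBasis i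

lemma lapEigenvector_vecMul_lapMatrix (i : V) :
    lapEigenvector G i ᵥ* G.lapMatrix ℝ = lapEigenvalues G i • lapEigenvector G i := by
  rw [← lapMatrix_mulVec_lapEigenvector, ← Matrix.mulVec_transpose, (G.isSymm_lapMatrix ℝ).eq]

lemma lapEigenvector_dotProduct (i k : V) :
    lapEigenvector G i ⬝ᵥ lapEigenvector G k = if i = k then 1 else 0 := by
  have := orthonormal_iff_ite.1 (G.posSemidef_lapMatrix ℝ).isHermitian.eigenvectorBasis.orthonormal
    k i
  rw [EuclideanSpace.inner_eq_star_dotProduct] at this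
  simpa [lapEigenvector, eq_comm] using this

lemma sum_lapEigenvector (x : V → ℝ) (j : V) :
    ∑ i, (lapEigenvector G i ⬝ᵥ x) * lapEigenvector G i j = x j := by
  have := congrArg (fun y : EuclideanSpace ℝ V => y j)
    ((G.posSemidef_lapMatrix ℝ).isHermitian.eigenvectorBasis.sum_repr' (WithLp.toLp 2 x))
  simpa [EuclideanSpace.inner_eq_star_dotProduct, lapEigenvector, dotProduct_comm] using this

lemma lapEigenvalues_nonneg (i : V) : 0 ≤ lapEigenvalues G i :=
  (G.posSemidef_lapMatrix ℝ).eigenvalues_nonneg i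

variable {G}

/-- The deviation from the average is the projection onto the modes with nonzero eigenvalue. -/
lemma sub_average_eq_sum {i₀ : V} (h0 : ∀ i, lapEigenvalues G i = 0 ↔ i = i₀) (x : V → ℝ) (j : V) :
    x j - (1 / (Fintype.card V : ℝ)) * ∑ k, x k =
      ∑ i with lapEigenvalues G i ≠ 0, (lapEigenvector G i ⬝ᵥ x) * lapEigenvector G i j := by
  set v := lapEigenvector G
  have hN : (Fintype.card V : ℝ) ≠ 0 := by
    have : Nonempty V := ⟨j⟩
    exact_mod_cast Fintype.card_ne_zero
  have h1 (i : V) (hi : i ≠ i₀) : v i ⬝ᵥ (fun _ => 1) = 0 := by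
    have h := congrArg (v i ⬝ᵥ ·) (G.lapMatrix_mulVec_const_eq_zero (R := ℝ))
    simp only [dotProduct_zero] at h
    rw [Matrix.dotProduct_mulVec, lapEigenvector_vecMul_lapMatrix, smul_dotProduct, smul_eq_mul,
      mul_eq_zero] at h
    exact h.resolve_left fun h => hi ((h0 i).1 h)
  set c := v i₀ ⬝ᵥ fun _ => 1
  -- The constant vector is orthogonal to all other modes, so expanding it shows that the zero mode
  -- is constant, with normalisation c² = N.
  have hone (k : V) : c * v i₀ k = 1 := by
    rw [← sum_lapEigenvector G (fun _ => 1) k, Finset.sum_eq_single i₀]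
    · intro i _ hi
      rw [h1 i hi, zero_mul]
    · simp
  have hc2 : c * c = Fintype.card V := by
    have : c * c = ∑ k, c * v i₀ k := by
      rw [← Finset.mul_sum]
      simp [c, dotProduct]
    rw [this]
    simp [hone]
  have hsum : ∑ k, x k = c * (v i₀ ⬝ᵥ x) := by
    rw [dotProduct, Finset.mul_sum]
    refine Finset.sum_congr rfl fun k _ => ?_
    rw [← mul_assoc, hone, one_mul]
  have hv : v i₀ j = c / Fintype.card V := by
    rw [← hc2]
    have hc : c ≠ 0 := fun h => by
      have := hone j
      simp [h] at this
    field_simp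
    linarith [hone j]
  have hfil : (Finset.univ.filter fun i => lapEigenvalues G i ≠ 0) = Finset.univ.erase i₀ := by
    ext i
    simp [h0]
  rw [hfil, ← sum_lapEigenvector G x j, ← Finset.add_sum_erase _ _ (Finset.mem_univ i₀), hsum]
  change (v i₀ ⬝ᵥ x) * v i₀ j + _ - _ = _
  rw [hv]
  ring

variable {Ω : Type*} [MeasurableSpace Ω] {P : Measure Ω} [IsProbabilityMeasure P]

/-- Summing over the vertices turns products of eigenvector entries into inner products, so
orthonormality kills the covariances between different modes, whether or not the modes are
independent. -/
lemma meanDeviationVariance_eq_sum {i₀ : V} (h0 : ∀ i, lapEigenvalues G i = 0 ↔ i = i₀)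
    {x : Ω → V → ℝ} (hx : ∀ i, lapEigenvalues G i ≠ 0 →
      MemLp (fun ω => lapEigenvector G i ⬝ᵥ x ω) 2 P) :
    meanDeviationVariance P x = (1 / (Fintype.card V : ℝ)) *
      ∑ i with lapEigenvalues G i ≠ 0, Var[fun ω => lapEigenvector G i ⬝ᵥ x ω; P] := by
  rw [meanDeviationVariance]
  congr 1
  simp_rw [sub_average_eq_sum h0]
  have hm (j : V) : ∀ i ∈ Finset.univ.filter fun i => lapEigenvalues G i ≠ 0,
      MemLp (fun ω => (lapEigenvector G i ⬝ᵥ x ω) * lapEigenvector G i j) 2 P :=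
    fun i hi => (hx i (Finset.mem_filter.1 hi).2).mul_const _
  simp_rw [fun j => variance_fun_sum' (hm j), covariance_mul_const_left, covariance_mul_const_right]
  rw [Finset.sum_comm]
  refine Finset.sum_congr rfl fun i hi => ?_
  rw [Finset.sum_comm, Finset.sum_eq_single i]
  · rw [covariance_self (hx i (Finset.mem_filter.1 hi).2).aemeasurable]
    simp_rw [mul_assoc]
    rw [← Finset.mul_sum]
    have := lapEigenvector_dotProduct G i i
    rw [if_pos rfl, dotProduct] at this
    rw [this, mul_one]
  · intro k _ hk
    simp_rw [mul_assoc]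
    rw [← Finset.mul_sum]
    have := lapEigenvector_dotProduct G k i
    rw [if_neg hk, dotProduct] at this
    rw [this, mul_zero]
  · exact fun h => absurd hi h

/-- The first order coherence is well defined for graphs with a single zero eigenvalue. -/
theorem isFirstOrderCoherence {i₀ : V} (h0 : ∀ i, lapEigenvalues G i = 0 ↔ i = i₀) :
    IsFirstOrderCoherence.{u} G (firstOrderCoherence G) := by
  intro Ω _ P _ W X hX
  set v := lapEigenvector G
  set ev := lapEigenvalues G with hev
  have hu (i : V) (τ : ℝ) : HasDerivAt (fun τ => Real.exp (-ev i * τ) • v i)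
      ((Real.exp (-ev i * τ) • v i) ᵥ* (-G.lapMatrix ℝ)) τ := by
    have h := (((hasDerivAt_id τ).const_mul (-ev i)).exp).smul_const (v i)
    rw [Matrix.vecMul_neg, Matrix.smul_vecMul, lapEigenvector_vecMul_lapMatrix]
    convert! h using 1
    simp [smul_smul, v, ev]
  have h1 (i : V) := hX.tendsto_variance (hu i)
  simp only [mul_zero, Real.exp_zero, one_smul] at h1
  have h2 (i : V) (hi : ev i ≠ 0) : Tendsto (fun t => Var[fun ω => v i ⬝ᵥ X t ω; P]) atTop
      (𝓝 (1 / (2 * ev i))) := by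
    have hpos : 0 < ev i := (lapEigenvalues_nonneg G i).lt_of_ne' hi
    refine (h1 i).2 _ ?_ ?_
    · have : Tendsto (fun t => Real.exp (-ev i * t)) atTop (𝓝 0) :=
        Real.tendsto_exp_atBot.comp (tendsto_id.const_mul_atTop_of_neg (neg_lt_zero.2 hpos))
      simpa using this.smul_const (v i)
    · refine (tendsto_integral_exp hpos).congr fun t => ?_
      refine intervalIntegral.integral_congr fun s _ => ?_
      have := lapEigenvector_dotProduct G i i
      rw [if_pos rfl, dotProduct] at this
      simp only [Matrix.vecMul_one, Pi.smul_apply, smul_eq_mul, mul_pow]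
      rw [← Finset.mul_sum]
      simp_rw [sq (v i _)]
      rw [this, mul_one]
  simp_rw [fun t => meanDeviationVariance_eq_sum h0 fun i _ => (h1 i).1 t]
  have h3 := (tendsto_finsetSum (Finset.univ.filter fun i => ev i ≠ 0)
    fun i hi => h2 i (Finset.mem_filter.1 hi).2).const_mul (1 / (Fintype.card V : ℝ))
  convert h3 using 2
  rw [firstOrderCoherence, Finset.mul_sum, Finset.mul_sum]
  refine Finset.sum_congr rfl fun i _ => ?_
  rw [← hev]
  ring

/-- The second order coherence is well defined for graphs with a single zero eigenvalue. -/
theorem isSecondOrderCoherence {i₀ : V} (h0 : ∀ i, lapEigenvalues G i = 0 ↔ i = i₀) :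
    IsSecondOrderCoherence.{u} G (secondOrderCoherence G) := by
  intro Ω _ P _ W X hX
  set v := lapEigenvector G
  set ev := lapEigenvalues G with hev
  have h2 (i : V) (hi : ev i ≠ 0) :
      (∀ t, MemLp (fun ω => v i ⬝ᵥ fun j => X t ω (Sum.inl j)) 2 P) ∧
      Tendsto (fun t => Var[fun ω => v i ⬝ᵥ fun j => X t ω (Sum.inl j); P]) atTop
        (𝓝 (1 / (2 * ev i ^ 2))) := by
    have hpos : 0 < ev i := (lapEigenvalues_nonneg G i).lt_of_ne' hi
    obtain ⟨p, q, hp0, hq0, hp, hq, hplim, hqlim, hint⟩ := exists_dampedMode hpos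
    -- On the span of one eigenvector in both blocks the adjoint system is p' = -λq, q' = p - λq.
    -- The start (1, 0) selects the position, and noise enters only through the velocity part q.
    have hu (τ : ℝ) : HasDerivAt (fun τ => Sum.elim (p τ • v i) (q τ • v i))
        (Sum.elim (p τ • v i) (q τ • v i) ᵥ*
          Matrix.fromBlocks 0 1 (-G.lapMatrix ℝ) (-G.lapMatrix ℝ)) τ := by
      rw [Matrix.vecMul_fromBlocks, hasDerivAt_pi]
      have hL : (q τ • v i) ᵥ* (-G.lapMatrix ℝ) = (-(ev i) * q τ) • v i := by
        rw [Matrix.vecMul_neg, Matrix.smul_vecMul, lapEigenvector_vecMul_lapMatrix, smul_smul,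
          ← neg_smul]
        congr 1
        ring
      rintro (j | j)
      · simpa [hL] using (hp τ).mul_const (v i j)
      · have := (hq τ).mul_const (v i j)
        simp [hL]
        convert! this using 1
        ring
    have hX' (t : ℝ≥0) : (fun ω => Sum.elim (p 0 • v i) (q 0 • v i) ⬝ᵥ X t ω) =
        fun ω => v i ⬝ᵥ fun j => X t ω (Sum.inl j) := by
      ext ω
      simp [hp0, hq0, dotProduct]
    have h1 := hX.tendsto_variance hu
    simp only [hX'] at h1
    refine ⟨h1.1, h1.2 _ ?_ ?_⟩
    · rw [tendsto_pi_nhds]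
      rintro (j | j)
      · simpa using hplim.mul_const (v i j)
      · simpa using hqlim.mul_const (v i j)
    · refine hint.congr fun t => ?_
      refine intervalIntegral.integral_congr fun s _ => ?_
      have := lapEigenvector_dotProduct G i i
      rw [if_pos rfl, dotProduct] at this
      simp only [Matrix.vecMul_fromRows, Matrix.vecMul_zero, zero_add, Matrix.vecMul_one,
        Function.comp_def, Sum.elim_inr, Pi.smul_apply, smul_eq_mul, mul_pow]
      rw [← Finset.mul_sum]
      simp_rw [sq (v i _)]
      rw [this, mul_one]
  simp_rw [fun t => meanDeviationVariance_eq_sum h0 (x := fun ω j => X t ω (Sum.inl j))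
    fun i hi => (h2 i hi).1 t]
  have h3 := (tendsto_finsetSum (Finset.univ.filter fun i => ev i ≠ 0)
    fun i hi => (h2 i (Finset.mem_filter.1 hi).2).2).const_mul (1 / (Fintype.card V : ℝ))
  convert h3 using 2
  rw [secondOrderCoherence, Finset.mul_sum, Finset.mul_sum]
  refine Finset.sum_congr rfl fun i _ => ?_
  rw [← hev]
  ring

end SpectralDecomposition

/-! ### Coherence of the Sierpiński gaskets -/

theorem theorem2 :
    -- numbers of vertices and edges
    (∀ n : ℕ, (Fintype.card (gasketVertices n) : ℝ) = (3 ^ (n + 1) + 3) / 2 ∧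
      (gasket n).edgeFinset.card = 3 ^ (n + 1)) ∧
    -- the coherences are well defined and given by the Laplacian spectrum
    (∀ n : ℕ, 1 ≤ n →
      IsFirstOrderCoherence.{u} (gasket n) (firstOrderCoherence (gasket n)) ∧
      IsSecondOrderCoherence.{u} (gasket n) (secondOrderCoherence (gasket n))) ∧
    -- exact values
    (∀ n : ℕ, 1 ≤ n →
      firstOrderCoherence (gasket n) =
        1 / (20 * 3 ^ (2 + n) * (1 + 3 ^ n) ^ 2) *
          (4 * 3 ^ n + 2 * 3 ^ (1 + 2 * n) - 3 ^ (1 + 3 * n) + 13 * 3 ^ (1 + n) * 5 ^ n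
            + 4 * 5 ^ (1 + n) + 14 * 45 ^ n) ∧
      secondOrderCoherence (gasket n) =
        1 / (400 * (1 + 3 ^ n) ^ 3 * 9 ^ (2 + n)) *
          (86 * 3 ^ (1 + 4 * n) - 2 * 3 ^ (2 + 5 * n) + 754 * 3 ^ (1 + 2 * n) * 5 ^ n
            + 568 * 3 ^ (1 + 3 * n) * 5 ^ n + 32 * 3 ^ (2 + n) * 5 ^ (1 + 2 * n) + 119 * 9 ^ n
            + 28 * 5 ^ n * 9 ^ (1 + 2 * n) + 64 * 15 ^ (1 + n) + 8 * 9 ^ (1 + 2 * n) * 25 ^ n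
            + 24 * 25 ^ (1 + n) + 320 * 27 ^ n + 1237 * 225 ^ n + 394 * 675 ^ n)) ∧
    -- leading scalings
    ((fun n : ℕ => firstOrderCoherence (gasket n)) ~[atTop] fun n : ℕ =>
      7 / 90 * (2 / 3 * (Fintype.card (gasketVertices n) : ℝ)) ^ (Real.logb 3 5 - 1)) ∧
    ((fun n : ℕ => secondOrderCoherence (gasket n)) ~[atTop] fun n : ℕ =>
      1 / 450 * (2 / 3 * (Fintype.card (gasketVertices n) : ℝ)) ^ (Real.logb 3 25 - 1)) ∧
    -- superlinear growth of the second-order coherence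
    ((fun n : ℕ => (Fintype.card (gasketVertices n) : ℝ)) =o[atTop]
      fun n : ℕ => secondOrderCoherence (gasket n)) := by
  refine ⟨fun n => ⟨card_gasketVertices n, card_edgeFinset_gasket n⟩, fun n _ => ?_,
    fun n _ => ⟨firstOrderCoherence_gasket n, secondOrderCoherence_gasket n⟩, ?_, ?_,
    card_isLittleO_secondOrderCoherence⟩
  · obtain ⟨i₀, h0⟩ := (gasket_spectrum n).1
    exact ⟨isFirstOrderCoherence h0, isSecondOrderCoherence h0⟩
  · have h := isEquivalent_card_rpow 5 (by norm_num)
    push_cast at h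
    exact isEquivalent_firstOrderCoherence.trans (IsEquivalent.refl.mul h.symm)
  · have h := isEquivalent_card_rpow 25 (by norm_num)
    push_cast at h
    exact isEquivalent_secondOrderCoherence.trans (IsEquivalent.refl.mul h.symm)
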